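/- Every algebraic action of the multiplicative group $\mathbb{C}^*$ on the affine plane $\mathbb{A}^2_{\mathbb{C}}$ is linearizable, and in fact diagonalizable. That is: let $\sigma:\mathbb{C}^*\times\mathbb{C}^2\to\mathbb{C}^2$ be a group action which is a morphism of algebraic varieties (both coordinates of $\sigma(t,(x,y))$ are polynomials in $t,t^{-1},x,y$). Then $\sigma$ is conjugate, by an automorphism of $\mathbb{A}^2_{\mathbb{C}}$, to a linear algebraic action; moreover, there are a polynomial automorphism $\varphi$ of $\mathbb{C}^2$ (a polynomial bijection with polynomial inverse) and integers $a,b\in\mathbb{Z}$ such that for all $t\in\mathbb{C}^*$ and $(x,y)\in\mathbb{C}^2$ $$\varphi\bigl(\sigma(t,\varphi^{-1}(x,y))\bigr)=(t^a x,\;t^b y).$$ -/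

import Mathlib

namespace CStarAction

/-- The complex points of affine `n`-space `𝔸ⁿ` over `ℂ`. -/
abbrev AffinePts (n : ℕ) : Type := Fin n → ℂ

/-- A map `𝔸ⁿ → 𝔸ⁿ` is a morphism of affine varieties iff its coordinates are polynomials. -/
def IsPolynomialMap {n : ℕ} (f : AffinePts n → AffinePts n) : Prop :=
  ∃ P : Fin n → MvPolynomial (Fin n) ℂ, ∀ x i, f x i = MvPolynomial.eval x (P i)

/-- Elements of `Aut(𝔸ⁿ)`: polynomial bijections whose inverse is polynomial as well. -/
def IsAutomorphism {n : ℕ} (φ : Equiv.Perm (AffinePts n)) : Prop :=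
  IsPolynomialMap φ ∧ IsPolynomialMap φ.symm

/-- An abstract action of the group `ℂ^*` on the points of `𝔸ⁿ` is an (algebraic)
`ℂ^*`-action if the action map `ℂ^* × 𝔸ⁿ → 𝔸ⁿ` is a morphism of varieties, that is, its
coordinates belong to the coordinate ring `ℂ[T, T⁻¹][X₁, …, Xₙ]` of `ℂ^* × 𝔸ⁿ`. -/
def IsAlgebraicAction {n : ℕ} (σ : ℂˣ →* Equiv.Perm (AffinePts n)) : Prop :=
  ∃ F : Fin n → MvPolynomial (Fin n) (LaurentPolynomial ℂ), ∀ (t : ℂˣ) (x : AffinePts n) (i : Fin n),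
    σ t x i = MvPolynomial.eval₂ (LaurentPolynomial.eval₂ (RingHom.id ℂ) t) x (F i)

/-- The action is linear: every group element acts by a linear map of `ℂⁿ`. -/
def IsLinearAction {n : ℕ} (σ : ℂˣ →* Equiv.Perm (AffinePts n)) : Prop :=
  ∀ t : ℂˣ, IsLinearMap ℂ (σ t)

/-- Two actions are conjugate by an element of `Aut(𝔸ⁿ)`. -/
def AreConjugate {n : ℕ} (σ τ : ℂˣ →* Equiv.Perm (AffinePts n)) : Prop :=
  ∃ φ : Equiv.Perm (AffinePts n), IsAutomorphism φ ∧ ∀ t : ℂˣ, φ * σ t * φ⁻¹ = τ t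

/-- The action is conjugate in `Aut(𝔸ⁿ)` to a linear algebraic `ℂ^*`-action. -/
def IsLinearizable {n : ℕ} (σ : ℂˣ →* Equiv.Perm (AffinePts n)) : Prop :=
  ∃ τ : ℂˣ →* Equiv.Perm (AffinePts n),
    IsAlgebraicAction τ ∧ IsLinearAction τ ∧ AreConjugate σ τ

/-- The diagonal action `t.(x₁, …, xₙ) = (t ^ w₁ x₁, …, t ^ wₙ xₙ)` with weights `wᵢ ∈ ℤ`. -/
def diagonalAction {n : ℕ} (w : Fin n → ℤ) : ℂˣ →* Equiv.Perm (AffinePts n) where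
  toFun t :=
    { toFun := fun x i => ((t ^ w i : ℂˣ) : ℂ) * x i
      invFun := fun x i => (((t ^ w i)⁻¹ : ℂˣ) : ℂ) * x i
      left_inv := fun x => by funext i; exact Units.inv_mul_cancel_left _ _
      right_inv := fun x => by funext i; exact Units.mul_inv_cancel_left _ _ }
  map_one' := by ext x i; simp
  map_mul' s t := by
    ext x i
    simp [mul_zpow, mul_assoc]

end CStarAction

/-! An algebraic `ℂ^*`-action is the same as a `ℤ`-grading of `A = ℂ[x, y]` by semi-invariants. If
two homogeneous elements `u`, `v` generate `A`, then `(u, v)` is an automorphism of the plane that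
diagonalizes the action, with the weights of `u` and `v` as exponents. So the heart of the matter is
`hasHomogeneousGenerators`. A trivial grading is clear; otherwise, up to reversing the grading,
there are three cases.

If `A₀` contains a nonconstant element, it has transcendence degree one, and Lüroth's theorem with
the normality of `A` gives `A₀ = ℂ[g]` (`exists_generator_zero`). With weights of both signs, a
translate of `g` is divisible by a prime `u` of positive weight and a prime `v` of negative weight.
Each nonzero homogeneous element is `u ^ i * v ^ j` times an element of `ℂ[g]`, and `g` itself is a
scalar times a monomial in `u`, `v`. With weights `≥ 0` and `A₀ ≠ ℂ`, a prime `w` of positive weight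
divides every element of positive weight, whence `A = ℂ[g, w]`. With weights `≥ 0` and `A₀ = ℂ`, all
elements of positive weight vanish at a common point; homogeneous `u`, `v` with independent
differentials there generate `A`, by induction on the weight. -/

namespace CStarAction

/-! ### Homogeneous elements of `ℤ`-graded algebras -/

section Graded

open DirectSum

variable {A : Type*} [CommRing A] [Algebra ℂ A]

/-- The opposite of a `ℤ`-grading. -/
noncomputable abbrev gradedAlgebraNeg (𝒜 : ℤ → Submodule ℂ A) [GradedAlgebra 𝒜] :
    GradedAlgebra fun n : ℤ => 𝒜 (-n) where
  one_mem := by simpa using SetLike.GradedOne.one_mem (A := 𝒜)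
  mul_mem i j f g hf hg := by
    rw [neg_add]
    exact SetLike.GradedMul.mul_mem hf hg
  toDecomposition := by
    refine IsInternal.chooseDecomposition _ (isInternal_submodule_of_iSupIndep_of_iSup_eq_top
      ((Decomposition.isInternal 𝒜).submodule_iSupIndep.comp neg_injective) ?_)
    rw [← (Decomposition.isInternal 𝒜).submodule_iSup_eq_top]
    exact (Equiv.neg ℤ).iSup_comp (g := 𝒜)

variable (𝒜 : ℤ → Submodule ℂ A) [GradedAlgebra 𝒜]

variable {𝒜} in
lemma pow_mem_of_mem {f : A} {n : ℤ} (hf : f ∈ 𝒜 n) (k : ℕ) : f ^ k ∈ 𝒜 (k * n) := by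
  simpa using SetLike.pow_mem_graded k hf

variable {𝒜} in
lemma eq_of_mem_of_mem {f : A} {m n : ℤ} (hm : f ∈ 𝒜 m) (hn : f ∈ 𝒜 n) (hf : f ≠ 0) :
    m = n := degree_eq_of_mem_mem 𝒜 hm hn hf

lemma algebraMap_mem_zero (c : ℂ) : algebraMap ℂ A c ∈ 𝒜 0 :=
  SetLike.algebraMap_mem_graded 𝒜 c

/-- A sum of degrees attained only once cannot cancel in `f * g`. Unless both supports are
singletons, `ℤ` provides two such pairs of degrees, but `f * g` has a single degree. -/
lemma factor_mem [IsDomain A] {f g : A} {n : ℤ} (hfg : f * g ∈ 𝒜 n) (h0 : f * g ≠ 0) :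
    ∃ k, f ∈ 𝒜 k ∧ g ∈ 𝒜 (n - k) := by
  classical
  set F := decompose 𝒜 f
  set G := decompose 𝒜 g
  have key : ∀ i ∈ F.support, ∀ j ∈ G.support, UniqueAdd F.support G.support i j → i + j = n := by
    intro i hi j hj hu
    have h1 : ((decompose 𝒜 (f * g) (i + j) : 𝒜 (i + j)) : A) = (F i : A) * (G j : A) := by
      rw [decompose_mul, coe_mul_apply, Finset.sum_eq_single (i, j)]
      · rintro ⟨a, b⟩ hab hne
        simp only [Finset.mem_filter, Finset.mem_product] at hab
        obtain ⟨ha, hb⟩ := hu hab.1.1 hab.1.2 hab.2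
        exact absurd (by rw [ha, hb]) hne
      · intro h
        exact absurd (by simpa using ⟨DFinsupp.mem_support_iff.mp hi,
          DFinsupp.mem_support_iff.mp hj⟩) h
    by_contra hne
    rw [decompose_of_mem_ne 𝒜 hfg (Ne.symm hne)] at h1
    have hF : (F i : A) ≠ 0 := by simpa using DFinsupp.mem_support_iff.mp hi
    have hG : (G j : A) ≠ 0 := by simpa using DFinsupp.mem_support_iff.mp hj
    exact mul_ne_zero hF hG h1.symm
  have hf0 := left_ne_zero_of_mul h0
  have hg0 := right_ne_zero_of_mul h0
  have hF0 : F.support.Nonempty := by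
    rw [Finset.nonempty_iff_ne_empty, Ne, DFinsupp.support_eq_empty]
    exact fun h => hf0 ((decompose 𝒜).injective (h.trans (decompose_zero 𝒜).symm))
  have hG0 : G.support.Nonempty := by
    rw [Finset.nonempty_iff_ne_empty, Ne, DFinsupp.support_eq_empty]
    exact fun h => hg0 ((decompose 𝒜).injective (h.trans (decompose_zero 𝒜).symm))
  have hcard : F.support.card * G.support.card = 1 := by
    by_contra hne
    have hpos : 0 < F.support.card * G.support.card := Nat.mul_pos hF0.card_pos hG0.card_pos
    obtain ⟨p, hp, q, hq, hpq, hup, huq⟩ :=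
      TwoUniqueSums.uniqueAdd_of_one_lt_card (A := F.support) (B := G.support) (by omega)
    rw [Finset.mem_product] at hp hq
    have hp' := key _ hp.1 _ hp.2 hup
    have hq' := key _ hq.1 _ hq.2 huq
    obtain ⟨e1, e2⟩ := hup hq.1 hq.2 (hq'.trans hp'.symm)
    exact hpq (Prod.ext e1.symm e2.symm)
  obtain ⟨hFc, hGc⟩ := mul_eq_one.mp hcard
  obtain ⟨i, hi⟩ := Finset.card_eq_one.mp hFc
  obtain ⟨j, hj⟩ := Finset.card_eq_one.mp hGc
  have hf : f ∈ 𝒜 i := by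
    rw [← sum_support_decompose 𝒜 f]
    change ∑ k ∈ F.support, (F k : A) ∈ _
    rw [hi, Finset.sum_singleton]
    exact SetLike.coe_mem _
  have hg : g ∈ 𝒜 j := by
    rw [← sum_support_decompose 𝒜 g]
    change ∑ k ∈ G.support, (G k : A) ∈ _
    rw [hj, Finset.sum_singleton]
    exact SetLike.coe_mem _
  have := eq_of_mem_of_mem (SetLike.mul_mem_graded hf hg) hfg h0
  refine ⟨i, hf, ?_⟩
  rwa [← this, add_sub_cancel_left]

variable {𝒜} in
lemma factor_mem_of_left [IsDomain A] {f g : A} {m n : ℤ} (hfg : f * g ∈ 𝒜 n) (h0 : f * g ≠ 0)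
    (hf : f ∈ 𝒜 m) : g ∈ 𝒜 (n - m) := by
  obtain ⟨k, hk, hg⟩ := factor_mem 𝒜 hfg h0
  rwa [eq_of_mem_of_mem hf hk (left_ne_zero_of_mul h0)]

/-- A homogeneous element of nonzero weight has a prime factor whose weight has the same sign. -/
lemma exists_prime_dvd [IsDomain A] [UniqueFactorizationMonoid A] (hU : ∀ f : A, IsUnit f → f ∈ 𝒜 0) (ε : ℤ)
    (f : A) (hf0 : f ≠ 0) : ∀ n, f ∈ 𝒜 n → 0 < ε * n →
    ∃ u k, Prime u ∧ u ∈ 𝒜 k ∧ 0 < ε * k ∧ u ∣ f := by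
  induction f using UniqueFactorizationMonoid.induction_on_prime with
  | h₁ => exact absurd rfl hf0
  | h₂ f hf =>
    intro n hn h
    rw [eq_of_mem_of_mem hn (hU f hf) hf0] at h
    simp at h
  | h₃ f p hf hp ih =>
    intro n hn h
    obtain ⟨k, hpk, hfk⟩ := factor_mem 𝒜 hn hf0
    by_cases hk : 0 < ε * k
    · exact ⟨p, k, hp, hpk, hk, dvd_mul_right _ _⟩
    · obtain ⟨u, l, hu, hul, hl, hd⟩ := ih hf (n - k) hfk (by rw [mul_sub]; linarith)
      exact ⟨u, l, hu, hul, hl, hd.mul_left _⟩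

/-- As `n ≠ 0`, distinct powers of `w` lie in distinct weights, so the coefficients of a polynomial
in `w` can be read off from its components. -/
lemma decompose_aeval {w : A} {n : ℤ} (hw : w ∈ 𝒜 n) (hn : n ≠ 0)
    (P : Polynomial (SetLike.GradeZero.subalgebra 𝒜)) (i : ℕ) :
    (decompose 𝒜 (Polynomial.aeval w P) (i * n) : A) = P.coeff i * w ^ i := by
  induction P using Polynomial.induction_on' with
  | add P Q hP hQ => simp [decompose_add, hP, hQ, add_mul]
  | monomial k c =>
    have hm : (c : A) * w ^ k ∈ 𝒜 (k * n) := by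
      simpa using SetLike.mul_mem_graded c.2 (pow_mem_of_mem hw k)
    rw [Polynomial.aeval_monomial, Polynomial.coeff_monomial]
    change (decompose 𝒜 ((c : A) * w ^ k) (i * n) : A) = _
    split_ifs with h
    · subst h
      rw [decompose_of_mem_same 𝒜 hm]
    · rw [decompose_of_mem_ne 𝒜 hm]
      · simp
      · simpa [hn] using h

lemma transcendental_of_mem [IsDomain A] {w : A} {n : ℤ} (hw : w ∈ 𝒜 n) (hn : n ≠ 0) (hw0 : w ≠ 0) :
    Transcendental (SetLike.GradeZero.subalgebra 𝒜) w := by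
  rw [transcendental_iff]
  intro P hP
  ext i
  have := decompose_aeval 𝒜 hw hn P i
  rw [hP] at this
  simpa [hw0] using this.symm

/-- Divisibility by a homogeneous element can be tested on homogeneous components. -/
lemma dvd_decompose {u f : A} {k : ℤ} (hu : u ∈ 𝒜 k) (h : u ∣ f) (n : ℤ) :
    u ∣ (decompose 𝒜 f n : A) := by
  obtain ⟨g, rfl⟩ := h
  refine ⟨decompose 𝒜 g (n - k), ?_⟩
  rw [← coe_decompose_mul_add_of_left_mem 𝒜 hu, add_sub_cancel]

end Graded

end CStarAction

/-! ### Transcendence degree in the coordinate ring of the plane -/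

namespace CStarAction

open Polynomial in
/-- Over `ℂ` a prime dividing a nonzero polynomial expression in `f` divides some `f - c`. -/
lemma exists_dvd_sub_of_dvd_aeval {A : Type*} [CommRing A] [Algebra ℂ A] {p f : A}
    (hp : Prime p) {P : ℂ[X]} (hP : P ≠ 0) (h : p ∣ aeval f P) :
    ∃ c : ℂ, p ∣ f - algebraMap ℂ A c := by
  rw [(IsAlgClosed.splits P).eq_prod_roots, map_mul, aeval_C] at h
  rcases hp.dvd_or_dvd h with h | h
  · exact absurd (isUnit_of_dvd_unit h (((leadingCoeff_ne_zero.mpr hP).isUnit).map _)) hp.not_isUnit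
  · rw [map_multiset_prod, Multiset.map_map] at h
    obtain ⟨q, hq, hd⟩ := hp.exists_mem_multiset_dvd h
    obtain ⟨c, -, rfl⟩ := Multiset.mem_map.mp hq
    exact ⟨c, by simpa using hd⟩

/-- The coordinate ring of the affine plane. -/
abbrev PlaneRing : Type := MvPolynomial (Fin 2) ℂ

/-- Lines through the origin suffice: if `g` is constant on each of them, its value everywhere is
the one at `0`. -/
lemma exists_line {g : PlaneRing} (hg : ∀ c, g ≠ algebraMap ℂ _ c) :
    ∃ ρ : PlaneRing →ₐ[ℂ] Polynomial ℂ, (ρ g).natDegree ≠ 0 := by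
  by_contra! h
  apply hg (MvPolynomial.eval 0 g)
  refine MvPolynomial.funext fun x => ?_
  specialize h (MvPolynomial.aeval fun i => Polynomial.C (x i) * Polynomial.X)
  obtain ⟨c, hc⟩ := Polynomial.natDegree_eq_zero.mp h
  have key (s : ℂ) : MvPolynomial.eval (fun i => x i * s) g = c := by
    have := congrArg (Polynomial.aeval s) hc
    rw [← AlgHom.comp_apply, MvPolynomial.comp_aeval] at this
    simpa [MvPolynomial.aeval_eq_eval] using this.symm
  have h0 := key 0
  have h1 := key 1
  simp only [mul_zero, mul_one] at h0 h1
  rw [h1, MvPolynomial.algebraMap_eq, MvPolynomial.eval_C, ← h0]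
  rfl

lemma transcendental_of_natDegree_ne_zero {h : Polynomial ℂ} (hh : h.natDegree ≠ 0) :
    Transcendental ℂ h := by
  rw [transcendental_iff]
  intro P hP
  have h1 : P.comp h = 0 := by
    rw [← hP, Polynomial.comp, Polynomial.aeval_def]; rfl
  have h2 := congrArg Polynomial.natDegree h1
  rw [Polynomial.natDegree_comp, Polynomial.natDegree_zero, mul_eq_zero, or_iff_left hh] at h2
  obtain ⟨c, rfl⟩ := Polynomial.natDegree_eq_zero.mp h2
  simpa using h1

lemma transcendental_of_nonconstant {g : PlaneRing} (hg : ∀ c, g ≠ algebraMap ℂ _ c) :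
    Transcendental ℂ g := by
  obtain ⟨ρ, hρ⟩ := exists_line hg
  exact fun h => transcendental_of_natDegree_ne_zero hρ (h.algHom ρ)

/-- Otherwise `a`, `b`, `c` would be algebraically independent, in a ring of transcendence degree
two. -/
lemma isAlgebraic_of_transcendental_pair {a b : PlaneRing} (ha : Transcendental ℂ a)
    (hb : Transcendental (Algebra.adjoin ℂ {a}) b) (c : PlaneRing) :
    IsAlgebraic (Algebra.adjoin ℂ {a, b}) c := by
  by_contra hc
  have h1 : AlgebraicIndependent ℂ fun _ : Unit => a :=
    algebraicIndependent_unique_type_iff.mpr ha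
  have h2 := (h1.option_iff_transcendental b).mpr (by rwa [Set.range_const])
  have h3 := (h2.option_iff_transcendental c).mpr (by
    have hset : Set.range (fun o : Option Unit => o.elim b fun _ => a) = {a, b} := by
      ext x
      simp [Option.exists, eq_comm, or_comm]
    rwa [hset])
  have := h3.cardinalMk_le_trdeg
  rw [MvPolynomial.trdeg_of_isDomain] at this
  simp at this
  norm_num at this

lemma isUnit_mem_zero (𝒜 : ℤ → Submodule ℂ PlaneRing) [GradedAlgebra 𝒜] (f : PlaneRing)
    (hf : IsUnit f) : f ∈ 𝒜 0 := by
  obtain ⟨r, -, rfl⟩ := MvPolynomial.isUnit_iff_eq_C_of_isReduced.mp hf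
  exact algebraMap_mem_zero 𝒜 r

lemma transcendental_of_le {S T : Subalgebra ℂ PlaneRing} (h : S ≤ T) {w : PlaneRing}
    (hw : Transcendental T w) : Transcendental S w := by
  rw [transcendental_iff] at hw ⊢
  intro P hP
  have h1 := hw (P.map (Subalgebra.inclusion h).toRingHom) (by
    rw [Polynomial.aeval_def, Polynomial.eval₂_map, ← hP]
    rfl)
  refine (Polynomial.map_eq_zero_iff (Subalgebra.inclusion_injective h)).mp h1

section

variable (𝒜 : ℤ → Submodule ℂ PlaneRing) [GradedAlgebra 𝒜]

lemma transcendental_adjoin {s : Set PlaneRing} (hs : ∀ f ∈ s, f ∈ 𝒜 0) {w : PlaneRing} {n : ℤ}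
    (hw : w ∈ 𝒜 n) (hn : n ≠ 0) (hw0 : w ≠ 0) : Transcendental (Algebra.adjoin ℂ s) w :=
  transcendental_of_le (Algebra.adjoin_le (S := SetLike.GradeZero.subalgebra 𝒜) hs)
    (transcendental_of_mem 𝒜 hw hn hw0)

/-- The degree zero part has transcendence degree at most one if the grading is not trivial. -/
lemma isAlgebraic_of_mem_zero {f g w : PlaneRing} (hf : f ∈ 𝒜 0) (hg : g ∈ 𝒜 0)
    (hgc : ∀ c, g ≠ algebraMap ℂ _ c) {n : ℤ} (hw : w ∈ 𝒜 n) (hn : n ≠ 0) (hw0 : w ≠ 0) :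
    IsAlgebraic (Algebra.adjoin ℂ {g}) f := by
  by_contra hfg
  exact transcendental_adjoin 𝒜 (s := {g, f}) (by rintro x (rfl | rfl) <;> assumption) hw hn hw0
    (isAlgebraic_of_transcendental_pair (transcendental_of_nonconstant hgc) hfg w)

/-- The degree zero part of a nontrivial grading embeds into a polynomial ring in one variable. -/
lemma exists_restriction {g w : PlaneRing} (hg : g ∈ 𝒜 0)
    (hgc : ∀ c, g ≠ algebraMap ℂ _ c) {n : ℤ} (hw : w ∈ 𝒜 n) (hn : n ≠ 0) (hw0 : w ≠ 0) :
    ∃ ρ : PlaneRing →ₐ[ℂ] Polynomial ℂ, (ρ g).natDegree ≠ 0 ∧ ∀ f ∈ 𝒜 0, ρ f = 0 → f = 0 := by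
  obtain ⟨ρ, hρ⟩ := exists_line hgc
  refine ⟨ρ, hρ, fun f hf hρf => ?_⟩
  by_contra hf0
  -- By algebraicity `f` divides some nonzero `P(g)`. If `ρ f = 0`, then `P(ρ g) = 0`, although `ρ
  -- g` is transcendental.
  obtain ⟨⟨r, hr⟩, hr0, hd⟩ :=
    (isAlgebraic_of_mem_zero 𝒜 hf hg hgc hw hn hw0).exists_nonzero_dvd
      (mem_nonZeroDivisors_of_ne_zero hf0)
  obtain ⟨P, rfl⟩ := (Algebra.adjoin_mem_exists_aeval ℂ g) hr
  have h1 : ρ f ∣ ρ (Polynomial.aeval g P) := map_dvd ρ hd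
  rw [hρf, zero_dvd_iff, ← Polynomial.aeval_algHom_apply] at h1
  have hP := (transcendental_iff.mp (transcendental_of_natDegree_ne_zero hρ)) P h1
  exact hr0 (Subtype.ext (by simp [hP]))

/-- If `g` has weight zero and is not constant, and `f` is homogeneous of nonzero weight, then each
homogeneous `w` divides some `r * f ^ i` with `r ≠ 0` of weight zero. -/
lemma exists_dvd_mul_pow {f g w : PlaneRing} (hg : g ∈ 𝒜 0)
    (hgc : ∀ c, g ≠ algebraMap ℂ _ c) {n : ℤ} (hf : f ∈ 𝒜 n) (hn : n ≠ 0) (hf0 : f ≠ 0)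
    {m : ℤ} (hw : w ∈ 𝒜 m) (hw0 : w ≠ 0) :
    ∃ r ∈ 𝒜 0, r ≠ 0 ∧ ∃ i : ℕ, w ∣ r * f ^ i := by
  obtain ⟨⟨r, hr⟩, hr0, hd⟩ :=
    (isAlgebraic_of_transcendental_pair (transcendental_of_nonconstant hgc)
      (transcendental_adjoin 𝒜 (s := {g}) (by simpa using hg) hf hn hf0) w).exists_nonzero_dvd
      (mem_nonZeroDivisors_of_ne_zero hw0)
  have hr0' : r ≠ 0 := fun h => hr0 (Subtype.ext h)
  -- The multiple `r` of `w` is a polynomial in `f` over the degree zero part; by homogeneity `w`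
  -- divides each of its terms.
  have hr' : r ∈ (Algebra.adjoin (SetLike.GradeZero.subalgebra 𝒜) {f}) := by
    have : Algebra.adjoin ℂ {g, f} ≤
        (Algebra.adjoin (SetLike.GradeZero.subalgebra 𝒜) {f}).restrictScalars ℂ := by
      refine Algebra.adjoin_le ?_
      rintro x (rfl | rfl)
      · exact Subalgebra.algebraMap_mem (Algebra.adjoin (SetLike.GradeZero.subalgebra 𝒜) {f})
          ⟨x, hg⟩
      · exact Algebra.self_mem_adjoin_singleton _ x
    exact this hr
  obtain ⟨P, rfl⟩ := Algebra.adjoin_mem_exists_aeval _ f hr'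
  have hP : P ≠ 0 := by
    rintro rfl
    simp at hr0'
  obtain ⟨i, hi⟩ : ∃ i, P.coeff i ≠ 0 := by
    by_contra! h
    exact hP (Polynomial.ext (by simpa using h))
  refine ⟨P.coeff i, (P.coeff i).2, fun h => hi (Subtype.ext h), i, ?_⟩
  rw [← decompose_aeval 𝒜 hf hn P i]
  exact dvd_decompose 𝒜 hw hd _

end

end CStarAction

/-! ### Lüroth's theorem for polynomials -/

namespace CStarAction

open Polynomial IntermediateField

section Luroth

/-- The value at `(a, b)` of the homogenization of degree `M` of `N`. -/
noncomputable def homogenizedEval {R : Type*} [CommRing R] [Algebra ℂ R] (N : ℂ[X]) (M : ℕ)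
    (a b : R) : R :=
  ∑ i ∈ Finset.range (M + 1), N.coeff i • (a ^ i * b ^ (M - i))

lemma homogenizedEval_eq {L : Type*} [Field L] [Algebra ℂ L] (N : ℂ[X]) {M : ℕ}
    (hM : N.natDegree ≤ M) (a : L) {b : L} (hb : b ≠ 0) :
    homogenizedEval N M a b = aeval (a / b) N * b ^ M := by
  rw [homogenizedEval, aeval_eq_sum_range' (Nat.lt_succ_of_le hM), Finset.sum_mul]
  refine Finset.sum_congr rfl fun i hi => ?_
  rw [smul_mul_assoc]
  congr 1
  have : i ≤ M := by simpa [Nat.lt_succ_iff] using hi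
  rw [div_pow, ← pow_mul_pow_sub b this]
  field_simp

lemma map_homogenizedEval {R S : Type*} [CommRing R] [Algebra ℂ R] [CommRing S] [Algebra ℂ S]
    (φ : R →ₐ[ℂ] S) (N : ℂ[X]) (M : ℕ) (a b : R) :
    φ (homogenizedEval N M a b) = homogenizedEval N M (φ a) (φ b) := by
  simp [homogenizedEval]

lemma homogenizedEval_zero {R : Type*} [CommRing R] [Algebra ℂ R] (N : ℂ[X]) (M : ℕ) (a : R) :
    homogenizedEval N M a 0 = N.coeff M • a ^ M := by
  rw [homogenizedEval, Finset.sum_range_succ, Finset.sum_eq_zero]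
  · simp
  · intro i hi
    have : M - i ≠ 0 := by have := Finset.mem_range.mp hi; omega
    simp [this]

/-- A generator of a Lüroth field with a pole at infinity. -/
lemma exists_generator_natDegree_lt (E : IntermediateField ℂ (RatFunc ℂ)) (hE : E ≠ ⊥) :
    ∃ p q : ℂ[X], IsCoprime p q ∧ q ≠ 0 ∧ q.natDegree < p.natDegree ∧
      E = ℂ⟮algebraMap ℂ[X] (RatFunc ℂ) p / algebraMap ℂ[X] (RatFunc ℂ) q⟯ := by
  set γ := RatFunc.Luroth.generator E with hγ
  have hEγ : E = ℂ⟮γ⟯ := RatFunc.Luroth.eq_adjoin_generator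
  have hC : ¬ ∃ c, γ = RatFunc.C c := RatFunc.Luroth.generator_ne_C hE
  obtain ⟨p, q, hp, hq, hpq⟩ : ∃ p q : ℂ[X], γ.num = p ∧ γ.denom = q ∧ IsCoprime p q :=
    ⟨_, _, rfl, rfl, RatFunc.isCoprime_num_denom γ⟩
  have hq0 : q ≠ 0 := hq ▸ RatFunc.denom_ne_zero γ
  have hγpq : γ = algebraMap ℂ[X] (RatFunc ℂ) p / algebraMap ℂ[X] (RatFunc ℂ) q := by
    rw [← hp, ← hq, RatFunc.num_div_denom]
  by_cases hlt : q.natDegree < p.natDegree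
  · exact ⟨p, q, hpq, hq0, hlt, by rw [← hγpq]; exact hEγ⟩
  push Not at hlt
  have hιq : algebraMap ℂ[X] (RatFunc ℂ) q ≠ 0 := by simpa using hq0
  -- Subtracting the value `c` of `γ` at infinity creates a zero there; inverting turns it into a
  -- pole.
  set c := p.coeff q.natDegree / q.leadingCoeff
  set r := p - C c * q with hr
  have hιr : algebraMap ℂ[X] (RatFunc ℂ) r =
      algebraMap ℂ[X] (RatFunc ℂ) p - RatFunc.C c * algebraMap ℂ[X] (RatFunc ℂ) q := by
    rw [hr, map_sub, map_mul, RatFunc.algebraMap_C]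
  have hr0 : r ≠ 0 := by
    intro h
    rw [h, map_zero] at hιr
    exact hC ⟨c, by rw [hγpq, div_eq_iff hιq]; exact (sub_eq_zero.mp hιr.symm)⟩
  have hrc : r.coeff q.natDegree = 0 := by
    have : q.leadingCoeff ≠ 0 := leadingCoeff_ne_zero.mpr hq0
    simp only [hr, coeff_sub, coeff_C_mul, coeff_natDegree, c]
    field_simp
    simp
  have hrle : r.natDegree ≤ q.natDegree :=
    (natDegree_sub_le _ _).trans (max_le hlt (natDegree_C_mul_le _ _))
  have hrlt : r.natDegree < q.natDegree := by
    refine lt_of_le_of_ne hrle fun h => hr0 ?_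
    rw [← leadingCoeff_eq_zero, leadingCoeff, h, hrc]
  have hιr0 : algebraMap ℂ[X] (RatFunc ℂ) r ≠ 0 := by simpa using hr0
  have hinv : algebraMap ℂ[X] (RatFunc ℂ) q / algebraMap ℂ[X] (RatFunc ℂ) r =
      (γ - RatFunc.C c)⁻¹ := by
    rw [hγpq, hιr]
    rw [hιr] at hιr0
    rw [div_sub' hιq, inv_div, mul_comm]
  refine ⟨q, r, ?_, hr0, hrlt, ?_⟩
  · have := (hpq.symm.add_mul_right_right (-C c))
    rwa [show p + -C c * q = r by rw [hr]; ring] at this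
  · have hCm (F : IntermediateField ℂ (RatFunc ℂ)) : RatFunc.C c ∈ F := F.algebraMap_mem c
    rw [hEγ, hinv]
    apply le_antisymm
    · rw [adjoin_simple_le_iff]
      have h1 := inv_mem (mem_adjoin_simple_self ℂ ((γ - RatFunc.C c)⁻¹))
      rw [inv_inv] at h1
      simpa using add_mem h1 (hCm _)
    · rw [adjoin_simple_le_iff]
      exact inv_mem (sub_mem (mem_adjoin_simple_self ℂ γ) (hCm _))

lemma exists_isCoprime_div {L : Type*} [Field L] [Algebra ℂ L] {h x : L} (hx : x ∈ ℂ⟮h⟯) :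
    ∃ N D : ℂ[X], IsCoprime N D ∧ aeval h D ≠ 0 ∧ x = aeval h N / aeval h D := by
  obtain ⟨N, D, rfl⟩ := (mem_adjoin_simple_iff ℂ x).mp hx
  by_cases hD : aeval h D = 0
  -- Here the denominator vanishes, so the fraction is `0` by convention.
  · exact ⟨0, 1, isCoprime_one_right, by simp, by simp [hD]⟩
  have hD0 : D ≠ 0 := by rintro rfl; simp at hD
  obtain ⟨N', hN⟩ := EuclideanDomain.gcd_dvd_left N D
  obtain ⟨D', hD'⟩ := EuclideanDomain.gcd_dvd_right N D
  have hbez := EuclideanDomain.gcd_eq_gcd_ab N D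
  generalize EuclideanDomain.gcdA N D = x at hbez
  generalize EuclideanDomain.gcdB N D = y at hbez
  generalize EuclideanDomain.gcd N D = d at hN hD' hbez
  subst hN hD'
  have hd0 : d ≠ 0 := left_ne_zero_of_mul hD0
  rw [map_mul] at hD
  refine ⟨N', D', ⟨x, y, mul_left_cancel₀ hd0 ?_⟩, right_ne_zero_of_mul hD, ?_⟩
  · linear_combination -hbez
  · rw [map_mul, map_mul, mul_div_mul_left _ _ (left_ne_zero_of_mul hD)]

/-- **Lüroth's theorem** for polynomials: the polynomials in a subfield of `ℂ(X)` that contains a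
nonconstant polynomial are the polynomials in one of them. -/
theorem exists_polynomial_generator (E : IntermediateField ℂ (RatFunc ℂ)) {f₀ : ℂ[X]}
    (hf₀ : f₀.natDegree ≠ 0) (hf₀E : algebraMap ℂ[X] (RatFunc ℂ) f₀ ∈ E) :
    ∃ h : ℂ[X], algebraMap ℂ[X] (RatFunc ℂ) h ∈ E ∧
      ∀ f : ℂ[X], algebraMap ℂ[X] (RatFunc ℂ) f ∈ E → ∃ N : ℂ[X], f = aeval h N := by
  have hE : E ≠ ⊥ := by
    rintro rfl
    obtain ⟨c, hc⟩ := mem_bot.mp hf₀E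
    rw [IsScalarTower.algebraMap_apply ℂ ℂ[X] (RatFunc ℂ)] at hc
    rw [← RatFunc.algebraMap_injective ℂ hc] at hf₀
    exact hf₀ (natDegree_C c)
  obtain ⟨p, q, hpq, hq0, hlt, hEpq⟩ := exists_generator_natDegree_lt E hE
  have hιq : algebraMap ℂ[X] (RatFunc ℂ) q ≠ 0 := by simpa using hq0
  have hnv : ∀ s : ℂ, q.eval s = 0 → p.eval s ≠ 0 := by
    obtain ⟨a, b, hab⟩ := hpq
    intro s h1 h2
    have := congrArg (eval s) hab
    simp [h1, h2] at this
  have hι (P : ℂ[X]) {M : ℕ} (hP : P.natDegree ≤ M) :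
      algebraMap ℂ[X] (RatFunc ℂ) (homogenizedEval P M p q) =
        aeval (algebraMap ℂ[X] (RatFunc ℂ) p / algebraMap ℂ[X] (RatFunc ℂ) q) P *
          algebraMap ℂ[X] (RatFunc ℂ) q ^ M :=
    (map_homogenizedEval (IsScalarTower.toAlgHom ℂ ℂ[X] (RatFunc ℂ)) P M p q).trans
      (homogenizedEval_eq P hP _ hιq)
  have key : ∀ f : ℂ[X], algebraMap ℂ[X] (RatFunc ℂ) f ∈ E → ∃ N D : ℂ[X], ∃ M : ℕ,
      M = max N.natDegree D.natDegree ∧ IsCoprime N D ∧ D ≠ 0 ∧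
      f * homogenizedEval D M p q = homogenizedEval N M p q := by
    intro f hf
    rw [hEpq] at hf
    obtain ⟨N, D, hND, hD0, hfND⟩ := exists_isCoprime_div hf
    refine ⟨N, D, _, rfl, hND, by rintro rfl; simp at hD0, ?_⟩
    apply RatFunc.algebraMap_injective ℂ
    rw [map_mul, hι N (le_max_left _ _), hι D (le_max_right _ _), hfND]
    rw [← mul_assoc, div_mul_cancel₀ _ hD0]
  have heval (s : ℂ) (P : ℂ[X]) (M : ℕ) :
      (homogenizedEval P M p q).eval s = homogenizedEval P M (p.eval s) (q.eval s) := by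
    have := map_homogenizedEval (aeval s) P M p q
    simpa using this
  have hDconst : ∀ f : ℂ[X], algebraMap ℂ[X] (RatFunc ℂ) f ∈ E → ∃ N : ℂ[X],
      f * q ^ N.natDegree = homogenizedEval N N.natDegree p q := by
    intro f hf
    obtain ⟨N, D, M, hM, hND, hD0, hf⟩ := key f hf
    -- A root `b` of `D` would be a value of `p / q` at some `s`, since `p - b * q` is nonconstant.
    -- There the polynomial `f` has no pole, so `N` vanishes at `b` too, against coprimality.
    have hD : D.natDegree = 0 := by
      by_contra hdeg
      obtain ⟨b, hb⟩ := IsAlgClosed.exists_root D (by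
        rw [Polynomial.degree_eq_natDegree hD0]; exact_mod_cast hdeg)
      have hdeg' : (p - C b * q).natDegree ≠ 0 := by
        rw [natDegree_sub_eq_left_of_natDegree_lt]
        · omega
        · exact (natDegree_C_mul_le _ _).trans_lt hlt
      obtain ⟨s, hs⟩ := IsAlgClosed.exists_root (p - C b * q) (fun h => hdeg'
        (natDegree_eq_of_degree_eq_some h))
      have hs' : p.eval s = b * q.eval s := by
        simpa [IsRoot, sub_eq_zero] using hs
      have hqs : q.eval s ≠ 0 := fun h => hnv s h (by rw [hs', h, mul_zero])
      have hdiv : p.eval s / q.eval s = b := by rw [hs']; field_simp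
      have h2 := congrArg (eval s) hf
      rw [eval_mul, heval, heval, homogenizedEval_eq _ (hM.symm ▸ le_max_right _ _) _ hqs,
        homogenizedEval_eq _ (hM.symm ▸ le_max_left _ _) _ hqs, hdiv] at h2
      simp only [coe_aeval_eq_eval, hb.eq_zero, zero_mul, mul_zero] at h2
      have hNb : N.eval b = 0 := by simpa [hqs] using h2.symm
      obtain ⟨x, y, hxy⟩ := hND
      have := congrArg (eval b) hxy
      simp [hNb, hb.eq_zero] at this
    obtain ⟨d, rfl⟩ := natDegree_eq_zero.mp hD
    have hd0 : d ≠ 0 := by simpa using hD0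
    rw [natDegree_C, max_eq_left (Nat.zero_le _)] at hM
    subst hM
    refine ⟨C d⁻¹ * N, ?_⟩
    have hdeg : (C d⁻¹ * N).natDegree = N.natDegree := natDegree_C_mul (inv_ne_zero hd0)
    rw [hdeg]
    have e1 : homogenizedEval (C d) N.natDegree p q = C d * q ^ N.natDegree := by
      rw [homogenizedEval, Finset.sum_eq_single 0]
      · simp [smul_eq_C_mul]
      · intro i _ hi
        simp [coeff_C, hi]
      · simp
    have e2 : homogenizedEval (C d⁻¹ * N) N.natDegree p q =
        C d⁻¹ * homogenizedEval N N.natDegree p q := by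
      simp only [homogenizedEval, Finset.mul_sum, coeff_C_mul, smul_eq_C_mul, map_mul, mul_assoc]
    rw [e2, ← hf, e1]
    have : C d⁻¹ * C d = (1 : ℂ[X]) := by rw [← C_mul, inv_mul_cancel₀ hd0, C_1]
    linear_combination (-(f * q ^ N.natDegree)) * this
  -- At a root `s` of `q` the left side of `hN` would vanish, while the right side is the leading
  -- coefficient of `N` times a power of `p(s) ≠ 0`. The degree of `N` is positive because `f₀` is
  -- nonconstant.
  have hqdeg : q.natDegree = 0 := by
    by_contra hdeg
    obtain ⟨s, hs⟩ := IsAlgClosed.exists_root q (fun h => hdeg (natDegree_eq_of_degree_eq_some h))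
    obtain ⟨N, hN⟩ := hDconst f₀ hf₀E
    have hs' : q.eval s = 0 := hs
    have h2 := congrArg (eval s) hN
    rw [heval, hs', homogenizedEval_zero, eval_mul, eval_pow, hs'] at h2
    by_cases hN0 : N.natDegree = 0
    · obtain ⟨c, rfl⟩ := natDegree_eq_zero.mp hN0
      simp [homogenizedEval] at hN
      rw [hN] at hf₀
      simp [smul_eq_C_mul] at hf₀
    · rw [zero_pow hN0, mul_zero, coeff_natDegree, eq_comm, smul_eq_zero] at h2
      rcases h2 with h2 | h2
      · rw [leadingCoeff_eq_zero] at h2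
        simp [h2] at hN0
      · exact hnv s hs' (pow_eq_zero_iff hN0 |>.mp h2)
  obtain ⟨e, rfl⟩ := natDegree_eq_zero.mp hqdeg
  have he : e ≠ 0 := by simpa using hq0
  have hpe : algebraMap ℂ[X] (RatFunc ℂ) (C e⁻¹ * p) =
      algebraMap ℂ[X] (RatFunc ℂ) p / algebraMap ℂ[X] (RatFunc ℂ) (C e) := by
    rw [eq_div_iff hιq, ← map_mul, mul_right_comm, ← C_mul, inv_mul_cancel₀ he, C_1, one_mul]
  refine ⟨C e⁻¹ * p, ?_, fun f hf => ?_⟩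
  · rw [hpe, hEpq]
    exact mem_adjoin_simple_self ℂ _
  · obtain ⟨N, hN⟩ := hDconst f hf
    refine ⟨N, RatFunc.algebraMap_injective ℂ ?_⟩
    have h3 := congrArg (algebraMap ℂ[X] (RatFunc ℂ)) hN
    rw [hι N le_rfl, map_mul, map_pow, ← hpe, aeval_algebraMap_apply] at h3
    exact mul_right_cancel₀ (pow_ne_zero _ hιq) h3

end Luroth

end CStarAction

/-! ### The degree zero part is `ℂ[g]` -/

namespace CStarAction

open Polynomial

lemma aeval_mem_zero {A : Type*} [CommRing A] [Algebra ℂ A] {𝒜 : ℤ → Submodule ℂ A}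
    [GradedAlgebra 𝒜] {f : A} (hf : f ∈ 𝒜 0) (N : ℂ[X]) : aeval f N ∈ 𝒜 0 :=
  Algebra.adjoin_le (S := SetLike.GradeZero.subalgebra 𝒜) (Set.singleton_subset_iff.mpr hf)
    (aeval_mem_adjoin_singleton ℂ f)

/-- A fraction `a / b` in a normal domain is integral as soon as a nonconstant polynomial
expression in it is. -/
lemma dvd_of_homogenizedEval_eq {A : Type*} [CommRing A] [IsDomain A] [IsIntegrallyClosed A]
    [Algebra ℂ A] {F : ℂ[X]} (hF : F.natDegree ≠ 0) {a b g : A} (hb : b ≠ 0)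
    (h : homogenizedEval F F.natDegree a b = g * b ^ F.natDegree) : b ∣ a := by
  set L := FractionRing A
  have hιb : algebraMap A L b ≠ 0 := by simpa using hb
  have h1 := congrArg (IsScalarTower.toAlgHom ℂ A L) h
  rw [map_homogenizedEval, map_mul, map_pow] at h1
  simp only [IsScalarTower.coe_toAlgHom'] at h1
  rw [homogenizedEval_eq F le_rfl _ hιb] at h1
  have h2 := mul_right_cancel₀ (pow_ne_zero _ hιb) h1
  have hF0 : F.leadingCoeff ≠ 0 := by
    rw [Ne, leadingCoeff_eq_zero]
    rintro rfl
    simp at hF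
  have hmonic : (F * C F.leadingCoeff⁻¹).Monic := monic_mul_leadingCoeff_inv (by simpa using hF0)
  have hint : IsIntegral A (algebraMap A L a / algebraMap A L b) := by
    refine IsIntegral.of_aeval_monic (p := (F * C F.leadingCoeff⁻¹).map (algebraMap ℂ A))
      (hmonic.map _) ?_ ?_
    · rw [hmonic.natDegree_map, natDegree_mul_C (inv_ne_zero hF0)]
      exact hF
    · rw [aeval_map_algebraMap, map_mul, aeval_C, h2,
        IsScalarTower.algebraMap_apply ℂ A L, ← map_mul]
      exact isIntegral_algebraMap
  obtain ⟨c, hc⟩ := IsIntegrallyClosed.isIntegral_iff.mp hint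
  refine ⟨c, IsFractionRing.injective A L ?_⟩
  rw [map_mul, hc, mul_div_cancel₀ _ hιb]

/-- The degree zero part of a nontrivial grading of the plane is generated by one element. -/
theorem exists_generator_zero (𝒜 : ℤ → Submodule ℂ PlaneRing) [GradedAlgebra 𝒜]
    {g₀ w : PlaneRing} (hg₀ : g₀ ∈ 𝒜 0) (hgc : ∀ c, g₀ ≠ algebraMap ℂ _ c) {n : ℤ}
    (hw : w ∈ 𝒜 n) (hn : n ≠ 0) (hw0 : w ≠ 0) :
    ∃ g ∈ 𝒜 0, ∀ f ∈ 𝒜 0, ∃ F : ℂ[X], f = aeval g F := by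
  obtain ⟨ρ, hρg, hρ⟩ := exists_restriction 𝒜 hg₀ hgc hw hn hw0
  set φ : PlaneRing →ₐ[ℂ] RatFunc ℂ := (IsScalarTower.toAlgHom ℂ ℂ[X] (RatFunc ℂ)).comp ρ
  have hφ (f : PlaneRing) : φ f = algebraMap ℂ[X] (RatFunc ℂ) (ρ f) := rfl
  have hφ0 : ∀ f ∈ 𝒜 0, φ f = 0 → f = 0 := fun f hf h =>
    hρ f hf (RatFunc.algebraMap_injective ℂ (by rw [map_zero]; exact h))
  set S : Subalgebra ℂ (RatFunc ℂ) := (SetLike.GradeZero.subalgebra 𝒜).map φ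
  set E := IntermediateField.adjoin ℂ (S : Set (RatFunc ℂ))
  have hE : ∀ f ∈ 𝒜 0, φ f ∈ E := fun f hf =>
    IntermediateField.subset_adjoin ℂ _ ⟨f, hf, rfl⟩
  obtain ⟨h, hhE, hgen⟩ := exists_polynomial_generator E hρg (hE g₀ hg₀)
  obtain ⟨a, ha, b, hb, hb0, hab⟩ : ∃ a ∈ 𝒜 0, ∃ b ∈ 𝒜 0, b ≠ 0 ∧
      algebraMap ℂ[X] (RatFunc ℂ) h = φ a / φ b := by
    obtain ⟨r, hr, s, hs, hrs⟩ := IntermediateField.mem_adjoin_iff_div.mp hhE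
    rw [Algebra.adjoin_eq] at hr hs
    obtain ⟨a, ha, rfl⟩ := hr
    obtain ⟨b, hb, rfl⟩ := hs
    by_cases hb0 : b = 0
    · subst hb0
      refine ⟨0, zero_mem _, 1, SetLike.GradedOne.one_mem, one_ne_zero, ?_⟩
      simpa using hrs
    · exact ⟨a, ha, b, hb, hb0, hrs⟩
  have hφb : φ b ≠ 0 := fun h => hb0 (hφ0 b hb h)
  obtain ⟨F, hF⟩ := hgen (ρ g₀) (hE g₀ hg₀)
  have hFdeg : F.natDegree ≠ 0 := by
    intro h0
    obtain ⟨c, rfl⟩ := natDegree_eq_zero.mp h0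
    rw [aeval_C] at hF
    rw [hF] at hρg
    exact hρg (natDegree_C c)
  -- A priori the Lüroth generator is only a fraction `a / b` of degree zero elements. The relation
  -- `F(a / b) = g₀`, cleared of denominators, makes it integral over the normal ring `PlaneRing`,
  -- so `b ∣ a`.
  have hhom : homogenizedEval F F.natDegree a b = g₀ * b ^ F.natDegree := by
    rw [← sub_eq_zero]
    refine hφ0 _ ?_ ?_
    · have ha' : a ∈ SetLike.GradeZero.subalgebra 𝒜 := ha
      have hb' : b ∈ SetLike.GradeZero.subalgebra 𝒜 := hb
      have hg' : g₀ ∈ SetLike.GradeZero.subalgebra 𝒜 := hg₀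
      change _ ∈ SetLike.GradeZero.subalgebra 𝒜
      refine sub_mem (sum_mem fun i _ => ?_) (mul_mem hg' (pow_mem hb' _))
      exact Subalgebra.smul_mem _ (mul_mem (pow_mem ha' _) (pow_mem hb' _)) _
    · rw [map_sub, map_homogenizedEval, homogenizedEval_eq F le_rfl _ hφb, ← hab, map_mul, map_pow,
        hφ g₀, hF, aeval_algebraMap_apply, sub_self]
  obtain ⟨c, rfl⟩ := dvd_of_homogenizedEval_eq hFdeg hb0 hhom
  have hc : c ∈ 𝒜 0 := by
    by_cases hc0 : c = 0
    · rw [hc0]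
      exact zero_mem _
    · simpa using factor_mem_of_left ha (mul_ne_zero hb0 hc0) hb
  have hρc : ρ c = h := by
    apply RatFunc.algebraMap_injective ℂ
    rw [hab, map_mul, mul_div_cancel_left₀ _ hφb]
    rfl
  refine ⟨c, hc, fun f hf => ?_⟩
  obtain ⟨N, hN⟩ := hgen (ρ f) (hE f hf)
  refine ⟨N, sub_eq_zero.mp (hρ _ (sub_mem hf (aeval_mem_zero hc N)) ?_)⟩
  rw [map_sub, hN, ← aeval_algHom_apply, hρc, sub_self]

end CStarAction

/-! ### Homogeneous generators when `A₀` contains a nonconstant element -/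

namespace CStarAction

open Polynomial DirectSum

section Generators

variable (𝒜 : ℤ → Submodule ℂ PlaneRing) [GradedAlgebra 𝒜]

/-- The grading has homogeneous coordinates: two homogeneous elements generating the algebra. -/
def HasHomogeneousGenerators (𝒜 : ℤ → Submodule ℂ PlaneRing) : Prop :=
  ∃ u v : PlaneRing, ∃ a b : ℤ, u ∈ 𝒜 a ∧ v ∈ 𝒜 b ∧ Algebra.adjoin ℂ {u, v} = ⊤

lemma adjoin_eq_top_of_forall_mem {u v : PlaneRing}
    (h : ∀ n, ∀ f ∈ 𝒜 n, f ≠ 0 → f ∈ Algebra.adjoin ℂ {u, v}) : Algebra.adjoin ℂ {u, v} = ⊤ := by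
  classical
  refine _root_.eq_top_iff.mpr fun f _ => ?_
  rw [← sum_support_decompose 𝒜 f]
  refine sum_mem fun i hi => h i _ (SetLike.coe_mem _) ?_
  simpa using DFinsupp.mem_support_iff.mp hi

lemma aeval_mem_of_mem {S : Subalgebra ℂ PlaneRing} {g : PlaneRing} (hg : g ∈ S) (F : ℂ[X]) :
    aeval g F ∈ S :=
  Algebra.adjoin_le (Set.singleton_subset_iff.mpr hg) (aeval_mem_adjoin_singleton ℂ g)

lemma hasHomogeneousGenerators_of_trivial (h : ∀ n ≠ 0, ∀ f ∈ 𝒜 n, f = 0) :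
    HasHomogeneousGenerators 𝒜 := by
  classical
  have hall (f : PlaneRing) : f ∈ 𝒜 0 := by
    rw [← sum_support_decompose 𝒜 f]
    refine sum_mem fun i hi => ?_
    by_cases hi0 : i = 0
    · subst hi0
      exact SetLike.coe_mem _
    · rw [h i hi0 _ (SetLike.coe_mem _)]
      exact zero_mem _
  refine ⟨MvPolynomial.X 0, MvPolynomial.X 1, 0, 0, hall _, hall _, ?_⟩
  rw [← MvPolynomial.adjoin_range_X]
  congr 1
  ext x
  simp [Fin.exists_fin_two, eq_comm]

/-! ### Weights of both signs -/

variable {𝒜}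

/-- In a grading whose degree zero part is `ℂ[g]`, let `u` and `v` be homogeneous primes dividing
`g`. Then `v` divides each homogeneous element whose weight has the sign opposite to that of `u`. -/
lemma dvd_of_mul_weight_neg {g u v h : PlaneRing}
    (hgen : ∀ f ∈ 𝒜 0, ∃ F : ℂ[X], f = aeval g F) (hug : u ∣ g) (hvg : v ∣ g) (hu : Prime u)
    (hv : Prime v) (hvu : ¬ v ∣ u) {a c : ℤ} (hua : u ∈ 𝒜 a) (hhc : h ∈ 𝒜 c) (hac : a * c < 0) :
    v ∣ h := by
  -- The exponents make the weights cancel, so this product is a polynomial in `g`. Its constant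
  -- term is zero because `u` divides both it and `g`; hence `g`, and with it `v`, divides the
  -- product.
  have hw : h ^ a.natAbs * u ^ c.natAbs ∈ 𝒜 0 := by
    have := SetLike.mul_mem_graded (pow_mem_of_mem hhc a.natAbs) (pow_mem_of_mem hua c.natAbs)
    convert this using 2
    rcases mul_neg_iff.mp hac with ⟨h1, h2⟩ | ⟨h1, h2⟩
    · rw [Int.natCast_natAbs, Int.natCast_natAbs, abs_of_pos h1, abs_of_neg h2]; ring
    · rw [Int.natCast_natAbs, Int.natCast_natAbs, abs_of_neg h1, abs_of_pos h2]; ring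
  have hc0 : c.natAbs ≠ 0 := by
    rintro h0
    rw [Int.natAbs_eq_zero.mp h0] at hac
    simp at hac
  obtain ⟨F, hF⟩ := hgen _ hw
  have hFg : g ∣ aeval g F - algebraMap ℂ _ (F.coeff 0) := by
    have h1 := map_dvd (aeval g) (X_dvd_sub_C (p := F))
    rwa [aeval_X, map_sub, aeval_C] at h1
  have hF0 : F.coeff 0 = 0 := by
    by_contra hne
    have h1 : u ∣ aeval g F := hF ▸ (dvd_pow_self u hc0).mul_left _
    have h2 : u ∣ algebraMap ℂ PlaneRing (F.coeff 0) := by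
      simpa using dvd_sub h1 (hug.trans hFg)
    exact hu.not_isUnit (isUnit_of_dvd_unit h2 ((Ne.isUnit hne).map _))
  rw [hF0, map_zero, sub_zero, ← hF] at hFg
  rcases hv.dvd_or_dvd (hvg.trans hFg) with h1 | h1
  · exact hv.dvd_of_dvd_pow h1
  · exact absurd (hv.dvd_of_dvd_pow h1) hvu

/-- Remove all factors `u` and `v`. By `dvd_of_mul_weight_neg` a cofactor of negative weight would
still be divisible by `v`, and one of positive weight by `u`. -/
lemma exists_eq_pow_mul_pow_mul {g u v f : PlaneRing}
    (hgen : ∀ f ∈ 𝒜 0, ∃ F : ℂ[X], f = aeval g F) (hug : u ∣ g) (hvg : v ∣ g) (hu : Prime u)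
    (hv : Prime v) (hvu : ¬ v ∣ u) (huv : ¬ u ∣ v) {a b : ℤ} (hua : u ∈ 𝒜 a) (hvb : v ∈ 𝒜 b)
    (ha : 0 < a) (hb : b < 0) {n : ℤ} (hf : f ∈ 𝒜 n) (hf0 : f ≠ 0) :
    ∃ (i j : ℕ) (h : PlaneRing), f = u ^ i * v ^ j * h ∧ h ∈ 𝒜 0 ∧ ¬ u ∣ h := by
  obtain ⟨r, hfr, hur⟩ :=
    (FiniteMultiplicity.of_not_isUnit hu.not_isUnit hf0).exists_eq_pow_mul_and_not_dvd
  generalize multiplicity u f = i at hfr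
  subst hfr
  have hr0 := right_ne_zero_of_mul hf0
  obtain ⟨h, hrh, hvh⟩ :=
    (FiniteMultiplicity.of_not_isUnit hv.not_isUnit hr0).exists_eq_pow_mul_and_not_dvd
  generalize multiplicity v r = j at hrh
  subst hrh
  have huh : ¬ u ∣ h := fun hd => hur (hd.mul_left _)
  refine ⟨i, j, h, by ring, ?_, huh⟩
  rw [← mul_assoc] at hf hf0
  obtain ⟨k, -, hk⟩ := factor_mem 𝒜 hf hf0
  rcases lt_trichotomy (n - k) 0 with hlt | heq | hgt
  · exact absurd (dvd_of_mul_weight_neg hgen hug hvg hu hv hvu hua hk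
      (mul_neg_of_pos_of_neg ha hlt)) hvh
  · rwa [heq] at hk
  · exact absurd (dvd_of_mul_weight_neg hgen hvg hug hv hu huv hvb hk
      (mul_neg_of_neg_of_pos hb hgt)) huh

/-- Primes dividing each other differ by a unit, and units have weight zero. -/
lemma not_dvd_of_weight_ne {u v : PlaneRing} (hu : Prime u) (hv : Prime v) {a b : ℤ}
    (hua : u ∈ 𝒜 a) (hvb : v ∈ 𝒜 b) (hab : a ≠ b) : ¬ u ∣ v := by
  intro hd
  obtain ⟨c, rfl⟩ := hd
  have hc : IsUnit c := (hv.irreducible.isUnit_or_isUnit rfl).resolve_left hu.not_isUnit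
  have hc0 := isUnit_mem_zero 𝒜 c hc
  have := SetLike.mul_mem_graded hua hc0
  rw [add_zero] at this
  exact hab (eq_of_mem_of_mem this hvb hv.ne_zero)

lemma ne_algebraMap_of_prime_dvd {u g : PlaneRing} (hu : Prime u) (hug : u ∣ g) (hg : g ≠ 0)
    (c : ℂ) : g ≠ algebraMap ℂ _ c := by
  rintro rfl
  have hc : c ≠ 0 := by rintro rfl; simp at hg
  exact hu.not_isUnit (isUnit_of_dvd_unit hug (hc.isUnit.map _))

lemma hasHomogeneousGenerators_of_pos_of_neg {p q : PlaneRing} {m n : ℤ} (hp : p ∈ 𝒜 m)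
    (hp0 : p ≠ 0) (hm : 0 < m) (hq : q ∈ 𝒜 n) (hq0 : q ≠ 0) (hn : n < 0) :
    HasHomogeneousGenerators 𝒜 := by
  obtain ⟨u, a, hu, hua, ha, -⟩ :=
    exists_prime_dvd 𝒜 (isUnit_mem_zero 𝒜) 1 p hp0 m hp (by simpa using hm)
  rw [one_mul] at ha
  have hz : u ^ n.natAbs * q ^ a.natAbs ∈ 𝒜 0 := by
    have := SetLike.mul_mem_graded (pow_mem_of_mem hua n.natAbs) (pow_mem_of_mem hq a.natAbs)
    convert this using 2
    rw [Int.natCast_natAbs, Int.natCast_natAbs, abs_of_pos ha, abs_of_neg hn]; ring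
  set z := u ^ n.natAbs * q ^ a.natAbs
  have hz0 : z ≠ 0 := mul_ne_zero (pow_ne_zero _ hu.ne_zero) (pow_ne_zero _ hq0)
  have huz : u ∣ z := (dvd_pow_self u (by omega)).mul_right _
  have hzc := ne_algebraMap_of_prime_dvd hu huz hz0
  obtain ⟨g₁, hg₁, hgen₁⟩ := exists_generator_zero 𝒜 hz hzc hp hm.ne' hp0
  obtain ⟨F, hF⟩ := hgen₁ z hz
  have hF0 : F ≠ 0 := by
    rintro rfl
    simp [hF] at hz0
  -- Replacing the generator by a translate makes it divisible by `u`; the cofactor then has weight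
  -- `-a < 0` and supplies `v`.
  obtain ⟨c, hc⟩ := exists_dvd_sub_of_dvd_aeval hu hF0 (hF ▸ huz)
  set g := g₁ - algebraMap ℂ _ c
  have hg : g ∈ 𝒜 0 := sub_mem hg₁ (algebraMap_mem_zero 𝒜 c)
  have hgen : ∀ f ∈ 𝒜 0, ∃ F : ℂ[X], f = aeval g F := by
    intro f hf
    obtain ⟨P, rfl⟩ := hgen₁ f hf
    refine ⟨P.comp (X + C c), ?_⟩
    rw [aeval_comp]
    simp [g]
  have hg0 : g ≠ 0 := by
    intro h0
    obtain ⟨P, hP⟩ := hgen z hz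
    refine hzc (P.coeff 0) ?_
    rw [hP, h0, ← coeff_zero_eq_aeval_zero']
  have htr := transcendental_of_nonconstant (ne_algebraMap_of_prime_dvd hu hc hg0)
  obtain ⟨k, hk⟩ := hc
  have hk0 : k ≠ 0 := by
    rintro rfl
    simp [hk] at hg0
  have hka : k ∈ 𝒜 (0 - a) := factor_mem_of_left (hk ▸ hg) (hk ▸ hg0) hua
  obtain ⟨v, b, hv, hvb, hb, hvk⟩ :=
    exists_prime_dvd 𝒜 (isUnit_mem_zero 𝒜) (-1) k hk0 _ hka (by linarith)
  have hb : b < 0 := by linarith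
  have hug : u ∣ g := hk ▸ dvd_mul_right u k
  have hvg : v ∣ g := hk ▸ hvk.mul_left u
  have hvu := not_dvd_of_weight_ne hv hu hvb hua (by omega)
  have huv := not_dvd_of_weight_ne hu hv hua hvb (by omega)
  set S := Algebra.adjoin ℂ {u, v}
  have huS : u ∈ S := Algebra.subset_adjoin (by simp)
  have hvS : v ∈ S := Algebra.subset_adjoin (by simp)
  have hgS : g ∈ S := by
    obtain ⟨i, j, h, hgh, hh, huh⟩ :=
      exists_eq_pow_mul_pow_mul hgen hug hvg hu hv hvu huv hua hvb ha hb hg hg0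
    have hh0 : h ≠ 0 := right_ne_zero_of_mul (hgh ▸ hg0)
    have huv0 : u ^ i * v ^ j ∈ 𝒜 0 := by
      have := factor_mem_of_left (f := h) (g := u ^ i * v ^ j) (n := 0)
        (by rw [mul_comm, ← hgh]; exact hg) (by rw [mul_comm, ← hgh]; exact hg0) hh
      simpa using this
    obtain ⟨H, hH⟩ := hgen h hh
    obtain ⟨K, hK⟩ := hgen _ huv0
    -- In `g = u ^ i * v ^ j * h` both the monomial and `h` are polynomials in the transcendental
    -- `g`. As `X` is irreducible, one of them is constant, and it must be `h`, since `u` divides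
    -- `g` but not `h`.
    have hKH : K * H = X := by
      have := (transcendental_iff.mp htr) (K * H - X) (by
        rw [map_sub, map_mul, aeval_X, ← hH, ← hK, ← hgh, sub_self])
      exact sub_eq_zero.mp this
    rcases (irreducible_X (R := ℂ)).isUnit_or_isUnit hKH.symm with hunit | hunit
    · exfalso
      have h1 : IsUnit (u ^ i * v ^ j) := hK ▸ hunit.map (aeval g)
      have h2 : u ∣ h := (hgh ▸ hug : u ∣ u ^ i * v ^ j * h) |> (h1.dvd_mul_left).mp
      exact huh h2
    · obtain ⟨e, -, rfl⟩ := Polynomial.isUnit_iff.mp hunit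
      rw [hgh, hH, aeval_C]
      exact mul_mem (mul_mem (pow_mem huS _) (pow_mem hvS _)) (S.algebraMap_mem e)
  refine ⟨u, v, a, b, hua, hvb, adjoin_eq_top_of_forall_mem 𝒜 fun n f hf hf0 => ?_⟩
  obtain ⟨i, j, h, rfl, hh, -⟩ :=
    exists_eq_pow_mul_pow_mul hgen hug hvg hu hv hvu huv hua hvb ha hb hf hf0
  obtain ⟨H, rfl⟩ := hgen h hh
  exact mul_mem (mul_mem (pow_mem huS _) (pow_mem hvS _)) (aeval_mem_of_mem hgS H)

/-! ### Nonnegative weights -/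

lemma hasHomogeneousGenerators_of_nonneg_of_nonconstant (hneg : ∀ n < 0, ∀ f ∈ 𝒜 n, f = 0)
    {p : PlaneRing} {m : ℤ} (hp : p ∈ 𝒜 m) (hp0 : p ≠ 0) (hm : 0 < m) {z : PlaneRing}
    (hz : z ∈ 𝒜 0) (hzc : ∀ c, z ≠ algebraMap ℂ _ c) : HasHomogeneousGenerators 𝒜 := by
  obtain ⟨w, a, hw, hwa, ha, -⟩ :=
    exists_prime_dvd 𝒜 (isUnit_mem_zero 𝒜) 1 p hp0 m hp (by simpa using hm)
  rw [one_mul] at ha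
  obtain ⟨g, hg, hgen⟩ := exists_generator_zero 𝒜 hz hzc hp hm.ne' hp0
  have hgw : g ∈ Algebra.adjoin ℂ {g, w} := Algebra.subset_adjoin (by simp)
  have hww : w ∈ Algebra.adjoin ℂ {g, w} := Algebra.subset_adjoin (by simp)
  -- `w` divides some `r * f ^ i` with `r` of weight zero; it cannot divide `r`, as the quotient
  -- would have negative weight.
  have hdvd {n : ℤ} (hn : 0 < n) {f : PlaneRing} (hf : f ∈ 𝒜 n) (hf0 : f ≠ 0) : w ∣ f := by
    obtain ⟨r, hr, hr0, i, hd⟩ := exists_dvd_mul_pow 𝒜 hz hzc hf hn.ne' hf0 hwa hw.ne_zero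
    rcases hw.dvd_or_dvd hd with ⟨k, rfl⟩ | h
    · have hk := factor_mem_of_left hr hr0 hwa
      exact absurd (hneg _ (by linarith) k hk) (right_ne_zero_of_mul hr0)
    · exact hw.dvd_of_dvd_pow h
  have key (N : ℕ) : ∀ n : ℤ, n.toNat = N → ∀ f ∈ 𝒜 n, f ≠ 0 → f ∈ Algebra.adjoin ℂ {g, w} := by
    induction N using Nat.strong_induction_on with
    | _ N ih =>
      intro n hN f hf hf0
      rcases lt_trichotomy n 0 with hlt | rfl | hgt
      · exact absurd (hneg n hlt f hf) hf0
      · obtain ⟨F, rfl⟩ := hgen f hf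
        exact aeval_mem_of_mem hgw F
      · obtain ⟨k, rfl⟩ := hdvd hgt hf hf0
        exact mul_mem hww (ih (n - a).toNat (by omega) _ rfl k (factor_mem_of_left hf hf0 hwa)
          (right_ne_zero_of_mul hf0))
  exact ⟨g, w, 0, a, hg, hwa, adjoin_eq_top_of_forall_mem 𝒜 fun n => key _ n rfl⟩

end Generators

end CStarAction

/-! ### Nonnegative weights with `A₀ = ℂ`, and the union of all cases -/

namespace CStarAction

open DirectSum

section Elliptic

/-- The ideal of functions vanishing at `x`. -/
noncomputable abbrev idealAt (x : Fin 2 → ℂ) : Ideal PlaneRing := RingHom.ker (MvPolynomial.eval x)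

/-- The partial derivatives of `f` at `x`. -/
noncomputable def partialAt (x : Fin 2 → ℂ) (i : Fin 2) : PlaneRing →ₗ[ℂ] ℂ :=
  (MvPolynomial.aeval x).toLinearMap ∘ₗ (MvPolynomial.pderiv i).toLinearMap

lemma partialAt_apply (x : Fin 2 → ℂ) (i : Fin 2) (f : PlaneRing) :
    partialAt x i f = MvPolynomial.eval x (MvPolynomial.pderiv i f) := rfl

/-- Taylor's formula of order one. -/
lemma sub_linearPart_mem_sq (x : Fin 2 → ℂ) (f : PlaneRing) :
    f - (MvPolynomial.C (MvPolynomial.eval x f) +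
      ∑ i, MvPolynomial.C (partialAt x i f) * (MvPolynomial.X i - MvPolynomial.C (x i))) ∈
      idealAt x * idealAt x := by
  have hX (i : Fin 2) : (MvPolynomial.X i - MvPolynomial.C (x i) : PlaneRing) ∈ idealAt x := by
    simp [RingHom.mem_ker]
  induction f using MvPolynomial.induction_on with
  | C a => simp [partialAt_apply]
  | add p q hp hq =>
    convert add_mem hp hq using 1
    simp only [map_add, Fin.sum_univ_two]
    ring
  | mul_X p j hp =>
    have h1 := Ideal.mul_mem_right (MvPolynomial.X j) _ hp
    have h2 : (∑ i, MvPolynomial.C (partialAt x i p) *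
        (MvPolynomial.X i - MvPolynomial.C (x i))) * (MvPolynomial.X j - MvPolynomial.C (x j)) ∈
        idealAt x * idealAt x :=
      Ideal.mul_mem_mul (sum_mem fun i _ => Ideal.mul_mem_left _ _ (hX i)) (hX j)
    convert add_mem h1 h2 using 1
    have h3 : ∑ i, MvPolynomial.C (partialAt x i (p * MvPolynomial.X j)) *
        (MvPolynomial.X i - MvPolynomial.C (x i)) =
        MvPolynomial.C (x j) * (∑ i, MvPolynomial.C (partialAt x i p) *
        (MvPolynomial.X i - MvPolynomial.C (x i))) +
        MvPolynomial.C (MvPolynomial.eval x p) * (MvPolynomial.X j - MvPolynomial.C (x j)) := by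
      fin_cases j <;>
      · simp [partialAt_apply, Fin.sum_univ_two, MvPolynomial.pderiv_X]
        ring
    rw [h3]
    simp only [map_mul, MvPolynomial.eval_X]
    ring

variable {𝒜 : ℤ → Submodule ℂ PlaneRing} [GradedAlgebra 𝒜]

/-- With no negative weights, the elements of positive weight generate an ideal without degree zero
components, so it does not contain `1`; the Nullstellensatz gives the point. -/
lemma exists_common_zero (hneg : ∀ n < 0, ∀ f ∈ 𝒜 n, f = 0) :
    ∃ x : Fin 2 → ℂ, ∀ n > 0, ∀ f ∈ 𝒜 n, MvPolynomial.eval x f = 0 := by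
  classical
  set I : Ideal PlaneRing := Ideal.span {f | ∃ n > 0, f ∈ 𝒜 n}
  have hI : I ≠ ⊤ := by
    intro h
    have h1 : (1 : PlaneRing) ∈ I := h ▸ Submodule.mem_top
    have h2 : ∀ f ∈ I, ∀ k ≤ 0, (decompose 𝒜 f k : PlaneRing) = 0 := by
      intro f hf
      induction hf using Submodule.span_induction with
      | mem f hf =>
        obtain ⟨n, hn, hf⟩ := hf
        exact fun k hk => decompose_of_mem_ne 𝒜 hf (by omega)
      | zero => simp
      | add f g _ _ hf hg =>
        intro k hk
        simp [decompose_add, hf k hk, hg k hk]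
      | smul c f _ hf =>
        intro k hk
        rw [smul_eq_mul, decompose_mul, coe_mul_apply]
        refine Finset.sum_eq_zero fun ij hij => ?_
        have hk' := (Finset.mem_filter.mp hij).2
        rcases lt_or_ge ij.1 0 with h | h
        · rw [hneg _ h _ (SetLike.coe_mem _), zero_mul]
        · rw [hf _ (by omega), mul_zero]
    have h3 := h2 1 h1 0 le_rfl
    rw [decompose_of_mem_same 𝒜 SetLike.GradedOne.one_mem] at h3
    exact one_ne_zero h3
  obtain ⟨M, hM, hIM⟩ := Ideal.exists_le_maximal I hI
  obtain ⟨x, rfl⟩ := MvPolynomial.isMaximal_iff_eq_vanishingIdeal_singleton.mp hM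
  refine ⟨x, fun n hn f hf => ?_⟩
  have := hIM (Ideal.subset_span ⟨n, hn, hf⟩)
  simpa [MvPolynomial.mem_vanishingIdeal_singleton_iff] using this

lemma decompose_zero_of_eval_eq_zero {x : Fin 2 → ℂ} (hneg : ∀ n < 0, ∀ f ∈ 𝒜 n, f = 0)
    (hconst : ∀ f ∈ 𝒜 0, ∃ c, f = algebraMap ℂ _ c)
    (hx : ∀ n > 0, ∀ f ∈ 𝒜 n, MvPolynomial.eval x f = 0) {f : PlaneRing}
    (hf : MvPolynomial.eval x f = 0) : (decompose 𝒜 f 0 : PlaneRing) = 0 := by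
  classical
  rw [← sum_support_decompose 𝒜 f, map_sum, Finset.sum_eq_single 0] at hf
  · obtain ⟨c, hc⟩ := hconst _ (decompose 𝒜 f 0).2
    rw [hc] at hf ⊢
    rw [MvPolynomial.algebraMap_eq, MvPolynomial.eval_C] at hf
    simp [hf]
  · intro i _ hi
    rcases lt_or_gt_of_ne hi with h | h
    · rw [hneg i h _ (SetLike.coe_mem _), map_zero]
    · exact hx i h _ (SetLike.coe_mem _)
  · intro h
    rw [DFinsupp.notMem_support_iff.mp h]
    simp

/-- The Jacobian determinant of `f` and `g` at `x`. -/
noncomputable def jacobianAt (x : Fin 2 → ℂ) (f g : PlaneRing) : ℂ :=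
  partialAt x 0 f * partialAt x 1 g - partialAt x 1 f * partialAt x 0 g

/-- The Jacobian is bilinear and equals `1` on the coordinates, so it is nonzero on some pair of
homogeneous components. Those of weight `≤ 0` are constants and contribute nothing. -/
lemma exists_jacobianAt_ne_zero (hneg : ∀ n < 0, ∀ f ∈ 𝒜 n, f = 0)
    (hconst : ∀ f ∈ 𝒜 0, ∃ c, f = algebraMap ℂ _ c) (x : Fin 2 → ℂ) :
    ∃ u v : PlaneRing, ∃ a > 0, ∃ b > 0, u ∈ 𝒜 a ∧ v ∈ 𝒜 b ∧ jacobianAt x u v ≠ 0 := by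
  classical
  by_contra! h
  have hc : ∀ i : Fin 2, ∀ n ≤ 0, ∀ f ∈ 𝒜 n, partialAt x i f = 0 := by
    intro i n hn f hf
    rcases hn.lt_or_eq with hlt | rfl
    · rw [hneg n hlt f hf, map_zero]
    · obtain ⟨c, rfl⟩ := hconst f hf
      simp [partialAt_apply]
  have h' : ∀ a b : ℤ, ∀ u ∈ 𝒜 a, ∀ v ∈ 𝒜 b, jacobianAt x u v = 0 := by
    intro a b u hu v hv
    by_cases ha : 0 < a
    · by_cases hb : 0 < b
      · exact h u v a ha b hb hu hv
      · simp [jacobianAt, hc _ b (not_lt.mp hb) v hv]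
    · simp [jacobianAt, hc _ a (not_lt.mp ha) u hu]
  have hsum : ∀ f g : PlaneRing, jacobianAt x f g = 0 := by
    intro f g
    have h1 : jacobianAt x f g = ∑ i ∈ (decompose 𝒜 f).support, ∑ j ∈ (decompose 𝒜 g).support,
        jacobianAt x (decompose 𝒜 f i) (decompose 𝒜 g j) := by
      conv_lhs => rw [← sum_support_decompose 𝒜 f, ← sum_support_decompose 𝒜 g]
      simp only [jacobianAt, map_sum, Finset.sum_mul_sum, Finset.sum_sub_distrib]
    rw [h1]
    exact Finset.sum_eq_zero fun i _ => Finset.sum_eq_zero fun j _ =>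
      h' i j _ (SetLike.coe_mem _) _ (SetLike.coe_mem _)
  have := hsum (MvPolynomial.X 0) (MvPolynomial.X 1)
  simp [jacobianAt, partialAt_apply, MvPolynomial.pderiv_X] at this

lemma mem_idealAt_sq {x : Fin 2 → ℂ} {f : PlaneRing} (hf : MvPolynomial.eval x f = 0)
    (h0 : partialAt x 0 f = 0) (h1 : partialAt x 1 f = 0) : f ∈ idealAt x * idealAt x := by
  simpa [hf, h0, h1, Fin.sum_univ_two] using sub_linearPart_mem_sq x f

/-- A graded Nakayama argument: `u` and `v` span the cotangent space at `x`, and the weight `n` part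
of the square of the maximal ideal is made of products of elements of smaller positive weights. -/
lemma hasHomogeneousGenerators_of_nonneg_of_constant (hneg : ∀ n < 0, ∀ f ∈ 𝒜 n, f = 0)
    (hconst : ∀ f ∈ 𝒜 0, ∃ c, f = algebraMap ℂ _ c) : HasHomogeneousGenerators 𝒜 := by
  classical
  obtain ⟨x, hx⟩ := exists_common_zero hneg
  obtain ⟨u, v, a, ha, b, hb, hu, hv, hJ⟩ := exists_jacobianAt_ne_zero hneg hconst x
  have huS : u ∈ Algebra.adjoin ℂ {u, v} := Algebra.subset_adjoin (by simp)
  have hvS : v ∈ Algebra.adjoin ℂ {u, v} := Algebra.subset_adjoin (by simp)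
  set S := Algebra.adjoin ℂ {u, v}
  have hcomp {k : ℤ} {h : PlaneRing} (hh : h ∈ 𝒜 k) (hhS : h ∈ S) (n : ℤ) :
      (decompose 𝒜 h n : PlaneRing) ∈ S := by
    by_cases hkn : k = n
    · subst hkn
      rwa [decompose_of_mem_same 𝒜 hh]
    · rw [decompose_of_mem_ne 𝒜 hh hkn]
      exact zero_mem _
  have key (N : ℕ) : ∀ n : ℤ, n.toNat = N → ∀ f ∈ 𝒜 n, f ≠ 0 → f ∈ S := by
    induction N using Nat.strong_induction_on with
    | _ N ih =>
      intro n hN f hf hf0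
      rcases lt_trichotomy n 0 with hlt | rfl | hgt
      · exact absurd (hneg n hlt f hf) hf0
      · obtain ⟨c, rfl⟩ := hconst f hf
        exact S.algebraMap_mem c
      have hsq : ∀ h ∈ idealAt x * idealAt x, (decompose 𝒜 h n : PlaneRing) ∈ S := by
        intro h hh
        induction hh using Submodule.mul_induction_on' with
        | mem_mul_mem p hp q hq =>
          have hp0 := decompose_zero_of_eval_eq_zero hneg hconst hx (RingHom.mem_ker.mp hp)
          have hq0 := decompose_zero_of_eval_eq_zero hneg hconst hx (RingHom.mem_ker.mp hq)
          rw [decompose_mul, coe_mul_apply]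
          refine sum_mem fun ij hij => ?_
          simp only [Finset.mem_filter, Finset.mem_product, DFinsupp.mem_support_iff, Ne,
            ← ZeroMemClass.coe_eq_zero] at hij
          obtain ⟨⟨hi, hj⟩, hijn⟩ := hij
          have hpos {r : PlaneRing} {i : ℤ} (hr0 : (decompose 𝒜 r 0 : PlaneRing) = 0)
              (hri : ¬ (decompose 𝒜 r i : PlaneRing) = 0) : 0 < i := by
            by_contra hle
            rcases (not_lt.mp hle).lt_or_eq with h | rfl
            · exact hri (hneg i h _ (SetLike.coe_mem _))
            · exact hri hr0
          have hi' := hpos hp0 hi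
          have hj' := hpos hq0 hj
          exact mul_mem (ih _ (by omega) ij.1 rfl _ (SetLike.coe_mem _) hi)
            (ih _ (by omega) ij.2 rfl _ (SetLike.coe_mem _) hj)
        | add p _ q _ hp hq =>
          rw [decompose_add]
          exact add_mem hp hq
      set J := jacobianAt x u v with hJdef
      -- Cramer's rule: `α • u + β • v` has the same differential at `x` as `f`.
      set α := jacobianAt x f v / J with hα
      set β := jacobianAt x u f / J with hβ
      have hrem : f - (α • u + β • v) ∈ idealAt x * idealAt x := by
        refine mem_idealAt_sq ?_ ?_ ?_
        · simp [MvPolynomial.smul_eval, hx n hgt f hf, hx a ha u hu, hx b hb v hv]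
        all_goals
          simp only [map_sub, map_add, map_smul, smul_eq_mul, hα, hβ]
          field_simp
          simp only [hJdef, jacobianAt]
          ring
      have h1 := hsq _ hrem
      -- The weights of `u` and `v` may differ from `n`, hence the projection to weight `n`.
      have h2 : f = (decompose 𝒜 (f - (α • u + β • v)) n : PlaneRing) +
          ((decompose 𝒜 (α • u) n : PlaneRing) + (decompose 𝒜 (β • v) n : PlaneRing)) := by
        have e : f = (f - (α • u + β • v)) + (α • u + β • v) := by ring
        have := congrArg (fun g => (decompose 𝒜 g n : PlaneRing)) e
        simpa only [decompose_add, DirectSum.add_apply, Submodule.coe_add,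
          decompose_of_mem_same 𝒜 hf] using this
      rw [h2]
      exact add_mem h1 (add_mem (hcomp (Submodule.smul_mem _ α hu) (S.smul_mem huS α) n)
        (hcomp (Submodule.smul_mem _ β hv) (S.smul_mem hvS β) n))
  exact ⟨u, v, a, b, hu, hv, adjoin_eq_top_of_forall_mem 𝒜 fun n => key _ n rfl⟩

lemma hasHomogeneousGenerators_of_nonneg (hneg : ∀ n < 0, ∀ f ∈ 𝒜 n, f = 0) :
    HasHomogeneousGenerators 𝒜 := by
  by_cases htriv : ∀ n ≠ 0, ∀ f ∈ 𝒜 n, f = 0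
  · exact hasHomogeneousGenerators_of_trivial 𝒜 htriv
  push Not at htriv
  obtain ⟨n, hn, f, hf, hf0⟩ := htriv
  have hpos : 0 < n := by
    by_contra h
    exact hf0 (hneg n (by omega) f hf)
  by_cases hconst : ∀ f ∈ 𝒜 0, ∃ c, f = algebraMap ℂ _ c
  · exact hasHomogeneousGenerators_of_nonneg_of_constant hneg hconst
  push Not at hconst
  obtain ⟨z, hz, hzc⟩ := hconst
  exact hasHomogeneousGenerators_of_nonneg_of_nonconstant hneg hf hf0 hpos hz hzc

variable (𝒜) in
/-- Every `ℤ`-grading of the polynomial ring in two variables over `ℂ` has homogeneous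
coordinates. -/
theorem hasHomogeneousGenerators : HasHomogeneousGenerators 𝒜 := by
  by_cases hneg : ∀ n < 0, ∀ f ∈ 𝒜 n, f = 0
  · exact hasHomogeneousGenerators_of_nonneg hneg
  by_cases hpos : ∀ n > 0, ∀ f ∈ 𝒜 n, f = 0
  · let _ := gradedAlgebraNeg 𝒜
    obtain ⟨u, v, a, b, hu, hv, h⟩ :=
      hasHomogeneousGenerators_of_nonneg (𝒜 := fun n : ℤ => 𝒜 (-n))
        fun n hn f hf => hpos (-n) (by omega) f hf
    exact ⟨u, v, -a, -b, hu, hv, h⟩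
  push Not at hneg hpos
  obtain ⟨n, hn, q, hq, hq0⟩ := hneg
  obtain ⟨m, hm, p, hp, hp0⟩ := hpos
  exact hasHomogeneousGenerators_of_pos_of_neg hp hp0 hm hq hq0 hn

end Elliptic

end CStarAction

/-! ### From algebraic actions to gradings -/

namespace CStarAction

section WeightSpaces

lemma two_zpow_injective : Function.Injective fun n : ℤ => (2 : ℂ) ^ n := by
  intro m n hmn
  have h2 := congrArg norm hmn
  simp only [norm_zpow, RCLike.norm_ofNat] at h2
  exact zpow_right_injective₀ (by norm_num) (by norm_num) h2

/-- Dedekind's independence of characters, applied to `s ↦ s ^ n`. -/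
lemma eq_zero_of_sum_zpow_eq_zero {S : Finset ℤ} {d : ℤ → ℂ}
    (h : ∀ s : ℂˣ, ∑ n ∈ S, d n * ((s ^ n : ℂˣ) : ℂ) = 0) : ∀ n ∈ S, d n = 0 := by
  let χ : ℤ → (ℂˣ →* ℂ) := fun n => (Units.coeHom ℂ).comp (zpowGroupHom n)
  have hχ : Function.Injective χ := by
    intro m n hmn
    have h2 := DFunLike.congr_fun hmn (Units.mk0 2 two_ne_zero)
    exact two_zpow_injective (by simpa [χ] using h2)
  have hli := (linearIndependent_monoidHom ℂˣ ℂ).comp χ hχ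
  rw [linearIndependent_iff'] at hli
  refine hli S d ?_
  ext s
  simpa [χ, Finset.sum_apply] using h s

lemma laurent_eval₂_eq_sum {R S : Type*} [CommRing R] [CommRing S] (f : R →+* S) (t : Sˣ)
    (L : LaurentPolynomial R) :
    LaurentPolynomial.eval₂ f t L =
      ∑ n ∈ L.coeff.support, f (L.coeff n) * ((t ^ n : Sˣ) : S) := by
  change _ = L.coeff.sum fun n a => f a * ((t ^ n : Sˣ) : S)
  induction L using LaurentPolynomial.induction_on' with
  | add p q hp hq =>
    rw [map_add, hp, hq, AddMonoidAlgebra.coeff_add, Finsupp.sum_add_index']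
    · simp
    · intro n a b
      rw [map_add, add_mul]
  | C_mul_T n a =>
    rw [LaurentPolynomial.eval₂_C_mul_T, ← LaurentPolynomial.single_eq_C_mul_T,
      AddMonoidAlgebra.coeff_single, Finsupp.sum_single_index]
    simp

variable (σ : ℂˣ →* Equiv.Perm (AffinePts 2))

/-- The semi-invariants of weight `n` of an action on the affine plane. -/
noncomputable def weightSpace (n : ℤ) : Submodule ℂ PlaneRing where
  carrier := {f | ∀ (t : ℂˣ) (x : AffinePts 2),
    MvPolynomial.eval (σ t x) f = ((t ^ n : ℂˣ) : ℂ) * MvPolynomial.eval x f}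
  add_mem' hf hg t x := by rw [map_add, map_add, hf t x, hg t x, mul_add]
  zero_mem' t x := by simp
  smul_mem' c f hf t x := by
    rw [MvPolynomial.smul_eval, MvPolynomial.smul_eval, hf t x]
    ring

variable {σ}

lemma exists_laurent_of_mvPolynomial (G : MvPolynomial (Fin 2) (LaurentPolynomial ℂ)) :
    ∃ L : LaurentPolynomial PlaneRing, ∀ (t : ℂˣ) (x : AffinePts 2),
      LaurentPolynomial.eval₂ (MvPolynomial.eval x) t L =
        MvPolynomial.eval₂ (LaurentPolynomial.eval₂ (RingHom.id ℂ) t) x G := by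
  induction G using MvPolynomial.induction_on with
  | C l =>
    induction l using LaurentPolynomial.induction_on' with
    | add p q hp hq =>
      obtain ⟨L, hL⟩ := hp
      obtain ⟨M, hM⟩ := hq
      exact ⟨L + M, fun t x => by rw [map_add, hL, hM, map_add, MvPolynomial.eval₂_add]⟩
    | C_mul_T n a =>
      exact ⟨LaurentPolynomial.C (MvPolynomial.C a) * LaurentPolynomial.T n, fun t x => by
        rw [MvPolynomial.eval₂_C, LaurentPolynomial.eval₂_C_mul_T,
          LaurentPolynomial.eval₂_C_mul_T, MvPolynomial.eval_C, RingHom.id_apply]⟩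
  | add p q hp hq =>
    obtain ⟨L, hL⟩ := hp
    obtain ⟨M, hM⟩ := hq
    exact ⟨L + M, fun t x => by rw [map_add, hL, hM, MvPolynomial.eval₂_add]⟩
  | mul_X p i hp =>
    obtain ⟨L, hL⟩ := hp
    exact ⟨L * LaurentPolynomial.C (MvPolynomial.X i), fun t x => by
      rw [map_mul, hL, LaurentPolynomial.eval₂_C, MvPolynomial.eval_X, MvPolynomial.eval₂_mul,
        MvPolynomial.eval₂_X]⟩

/-- The coaction of an algebraic action on the coordinate ring. -/
lemma exists_laurent (hσ : IsAlgebraicAction σ) (f : PlaneRing) :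
    ∃ L : LaurentPolynomial PlaneRing, ∀ (t : ℂˣ) (x : AffinePts 2),
      LaurentPolynomial.eval₂ (MvPolynomial.eval x) t L = MvPolynomial.eval (σ t x) f := by
  obtain ⟨F, hF⟩ := hσ
  induction f using MvPolynomial.induction_on with
  | C a =>
    exact ⟨LaurentPolynomial.C (MvPolynomial.C a), fun t x => by
      rw [LaurentPolynomial.eval₂_C, MvPolynomial.eval_C, MvPolynomial.eval_C]⟩
  | add p q hp hq =>
    obtain ⟨L, hL⟩ := hp
    obtain ⟨M, hM⟩ := hq
    exact ⟨L + M, fun t x => by rw [map_add, hL, hM, map_add]⟩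
  | mul_X p i hp =>
    obtain ⟨L, hL⟩ := hp
    obtain ⟨M, hM⟩ := exists_laurent_of_mvPolynomial (F i)
    exact ⟨L * M, fun t x => by rw [map_mul, hL, hM, map_mul, MvPolynomial.eval_X, hF]⟩

lemma iSup_weightSpace (hσ : IsAlgebraicAction σ) : ⨆ n, weightSpace σ n = ⊤ := by
  refine _root_.eq_top_iff.mpr fun f _ => ?_
  obtain ⟨L, hL⟩ := exists_laurent hσ f
  simp only [laurent_eval₂_eq_sum] at hL
  -- Expand `f(s·(t·x)) = f((s * t)·x)` in powers of `s` and compare coefficients.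
  have hmem : ∀ n ∈ L.coeff.support, L.coeff n ∈ weightSpace σ n := by
    intro n hn t x
    rw [← sub_eq_zero]
    refine eq_zero_of_sum_zpow_eq_zero (S := L.coeff.support) (d := fun n =>
      MvPolynomial.eval (σ t x) (L.coeff n) - ((t ^ n : ℂˣ) : ℂ) * MvPolynomial.eval x (L.coeff n))
      (fun s => ?_) n hn
    have h1 := hL s (σ t x)
    have h2 := hL (s * t) x
    rw [map_mul, Equiv.Perm.mul_apply, ← h1] at h2
    rw [← sub_eq_zero.mpr h2.symm, ← Finset.sum_sub_distrib]
    refine Finset.sum_congr rfl fun k _ => ?_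
    rw [mul_zpow, Units.val_mul]
    ring
  have hf : f = ∑ n ∈ L.coeff.support, L.coeff n := by
    refine MvPolynomial.funext fun x => ?_
    have := hL 1 x
    simpa using this.symm
  rw [hf]
  exact sum_mem fun n hn => Submodule.mem_iSup_of_mem n (hmem n hn)

/-- The single group element `t = 2` separates the weights: its pullback `T` acts on weight `n` by
`2 ^ n`, and these eigenvalues are distinct. -/
lemma iSupIndep_weightSpace (hσ : IsAlgebraicAction σ) : iSupIndep (weightSpace σ) := by
  obtain ⟨F, hF⟩ := hσ
  let t : ℂˣ := Units.mk0 2 two_ne_zero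
  let T : PlaneRing →ₗ[ℂ] PlaneRing := (MvPolynomial.aeval fun i =>
    MvPolynomial.map (LaurentPolynomial.eval₂ (RingHom.id ℂ) t) (F i)).toLinearMap
  have hT (f : PlaneRing) (x : AffinePts 2) :
      MvPolynomial.eval x (T f) = MvPolynomial.eval (σ t x) f := by
    have h1 : (fun i => MvPolynomial.eval x
        (MvPolynomial.map (LaurentPolynomial.eval₂ (RingHom.id ℂ) t) (F i))) = σ t x := by
      ext i
      rw [hF, MvPolynomial.eval_map]
    rw [← h1]
    change (MvPolynomial.aeval x) (MvPolynomial.aeval _ f) = _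
    rw [← AlgHom.comp_apply, MvPolynomial.comp_aeval]
    rfl
  have hinj : Function.Injective fun n : ℤ => ((t ^ n : ℂˣ) : ℂ) := by
    intro m n hmn
    exact two_zpow_injective (by simpa [t] using hmn)
  refine ((Module.End.eigenspaces_iSupIndep T).comp hinj).mono fun n f hf => ?_
  rw [Function.comp_apply, Module.End.mem_eigenspace_iff]
  refine MvPolynomial.funext fun x => ?_
  rw [hT, hf t x, MvPolynomial.smul_eval]

/-- An algebraic action on the affine plane grades the coordinate ring. -/
noncomputable abbrev weightGradedAlgebra (hσ : IsAlgebraicAction σ) :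
    GradedAlgebra (weightSpace σ) where
  one_mem t x := by simp
  mul_mem i j f g hf hg t x := by
    rw [map_mul, map_mul, hf t x, hg t x, zpow_add, Units.val_mul]
    ring
  toDecomposition := DirectSum.IsInternal.chooseDecomposition _
    (DirectSum.isInternal_submodule_of_iSupIndep_of_iSup_eq_top (iSupIndep_weightSpace hσ)
      (iSup_weightSpace hσ))

end WeightSpaces

/-! ### From homogeneous generators to a diagonalizing automorphism -/

lemma injective_of_surjective_ringEndomorphism {R : Type*} [CommRing R] [IsNoetherianRing R]
    (f : R →+* R) (hf : Function.Surjective f) : Function.Injective f := by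
  have hker (n : ℕ) (x : R) : x ∈ RingHom.ker (f ^ n) ↔ f^[n] x = 0 := by
    rw [RingHom.mem_ker, RingHom.coe_pow]
  let K : ℕ →o Ideal R := ⟨fun n => RingHom.ker (f ^ n), monotone_nat_of_le_succ fun n x hx => by
    rw [hker] at hx ⊢
    rw [Function.iterate_succ_apply', hx, map_zero]⟩
  -- The kernels of the iterates stabilize at `N`. Writing `x = f^[N] y`, the equation `f x = 0`
  -- puts `y` in the kernel of `f ^ (N + 1)`, hence of `f ^ N`.
  obtain ⟨N, hN⟩ := monotone_stabilizes_iff_noetherian.mpr ‹IsNoetherianRing R› K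
  rw [injective_iff_map_eq_zero]
  intro x hx
  obtain ⟨y, rfl⟩ := hf.iterate N x
  have h1 : y ∈ RingHom.ker (f ^ (N + 1)) := by
    rw [hker, Function.iterate_succ_apply', hx]
  rw [← hker]
  exact (hN (N + 1) (Nat.le_succ N)).ge h1

/-- Two generators of the coordinate ring are the coordinates of an automorphism of the plane. -/
lemma exists_automorphism {U : Fin 2 → PlaneRing}
    (hU : Algebra.adjoin ℂ (Set.range U) = ⊤) :
    ∃ φ : Equiv.Perm (AffinePts 2), IsAutomorphism φ ∧
      ∀ x i, φ x i = MvPolynomial.eval x (U i) := by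
  let Θ : PlaneRing →ₐ[ℂ] PlaneRing := MvPolynomial.aeval U
  have hsurj : Function.Surjective Θ := by
    rw [← AlgHom.range_eq_top, ← hU, Algebra.adjoin_range_eq_range_aeval]
  have hinj : Function.Injective Θ :=
    injective_of_surjective_ringEndomorphism Θ.toRingHom hsurj
  choose V hV using fun i => hsurj (MvPolynomial.X i)
  have hVU (i : Fin 2) : MvPolynomial.aeval V (U i) = MvPolynomial.X i := by
    apply hinj
    have h1 : Θ.comp (MvPolynomial.aeval V) = AlgHom.id ℂ PlaneRing := by
      ext i : 1
      simp [hV]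
    rw [← AlgHom.comp_apply, h1]
    simp [Θ]
  have heval (x : AffinePts 2) (W : Fin 2 → PlaneRing) (f : PlaneRing) :
      MvPolynomial.eval (fun i => MvPolynomial.eval x (W i)) f =
        MvPolynomial.eval x (MvPolynomial.aeval W f) := by
    change _ = (MvPolynomial.aeval x) (MvPolynomial.aeval W f)
    rw [← AlgHom.comp_apply, MvPolynomial.comp_aeval]
    rfl
  let φ : Equiv.Perm (AffinePts 2) :=
    { toFun := fun x i => MvPolynomial.eval x (U i)
      invFun := fun x i => MvPolynomial.eval x (V i)
      left_inv := fun x => by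
        ext i
        refine (heval x U (V i)).trans ?_
        rw [show MvPolynomial.aeval U (V i) = MvPolynomial.X i from hV i,
          MvPolynomial.eval_X]
      right_inv := fun x => by
        ext i
        refine (heval x V (U i)).trans ?_
        rw [hVU, MvPolynomial.eval_X] }
  exact ⟨φ, ⟨⟨U, fun _ _ => rfl⟩, ⟨V, fun _ _ => rfl⟩⟩, fun _ _ => rfl⟩

theorem exists_conjugate_diagonalAction {σ : ℂˣ →* Equiv.Perm (AffinePts 2)}
    (hσ : IsAlgebraicAction σ) : ∃ w : Fin 2 → ℤ, AreConjugate σ (diagonalAction w) := by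
  let _ := weightGradedAlgebra hσ
  obtain ⟨u, v, a, b, hu, hv, huv⟩ := hasHomogeneousGenerators (weightSpace σ)
  obtain ⟨φ, hφ, hφU⟩ := exists_automorphism (U := ![u, v]) (by
    rw [← huv]
    congr 1
    ext x
    simp [eq_comm, or_comm])
  refine ⟨![a, b], φ, hφ, fun t => ?_⟩
  rw [mul_inv_eq_iff_eq_mul]
  ext x i
  change φ (σ t x) i = ((t ^ ![a, b] i : ℂˣ) : ℂ) * φ x i
  rw [hφU, hφU]
  fin_cases i
  · exact hu t x
  · exact hv t x

lemma isAlgebraicAction_diagonalAction {n : ℕ} (w : Fin n → ℤ) :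
    IsAlgebraicAction (diagonalAction w) := by
  refine ⟨fun i => MvPolynomial.C (LaurentPolynomial.T (w i)) * MvPolynomial.X i, fun t x i => ?_⟩
  rw [MvPolynomial.eval₂_mul, MvPolynomial.eval₂_C, MvPolynomial.eval₂_X,
    LaurentPolynomial.eval₂_T]
  rfl

lemma isLinearAction_diagonalAction {n : ℕ} (w : Fin n → ℤ) :
    IsLinearAction (diagonalAction w) := fun _ =>
  { map_add := fun _ _ => funext fun _ => mul_add _ _ _
    map_smul := fun _ _ => funext fun _ => mul_left_comm _ _ _ }

end CStarAction

theorem corollary4p3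
    (σ : ℂˣ →* Equiv.Perm (CStarAction.AffinePts 2))
    (hσ : CStarAction.IsAlgebraicAction σ) :
    CStarAction.IsLinearizable σ ∧
      ∃ w : Fin 2 → ℤ, CStarAction.AreConjugate σ (CStarAction.diagonalAction w) := by
  obtain ⟨w, hw⟩ := CStarAction.exists_conjugate_diagonalAction hσ
  exact ⟨⟨CStarAction.diagonalAction w, CStarAction.isAlgebraicAction_diagonalAction w,
    CStarAction.isLinearAction_diagonalAction w, hw⟩, w, hw⟩
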